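/- A category $\mathscr C$ of right modules over a ring has CSL (the converse of Schur's Lemma) if every module in $\mathscr C$ whose endomorphism ring is a division ring is simple. For a ring $R$ let $\mathrm{Mod}\text{-}R$ be the category of right $R$-modules and $\mathrm{FinLen}\text{-}R$ its full subcategory of modules of finite length. The right Gabriel quiver of $R$ has as points the isomorphism classes of simple right $R$-modules, with an arrow from $S$ to $T$ whenever $\operatorname{Ext}^1_R(S,T)\neq 0$; it is totally disconnected if there is no arrow between two different points. A finite-dimensional $k$-algebra $A$ is elementary if $A/\operatorname{rad}(A)$ is isomorphic, as a $k$-algebra, to a finite direct product of copies of $k$, where $\operatorname{rad}(A)$ is the Jacobson radical. Let $k$ be a finite field with $q$ elements and let $A$ be a nonzero finite-dimensional elementary $k$-algebra whose right Gabriel quiver is totally disconnected. Then there exists a (left and right) noetherian ring $R$ such that: (i) the categories $\mathrm{FinLen}\text{-}A$ and $\mathrm{FinLen}\text{-}R$ are equivalent; (ii) both $\mathrm{FinLen}\text{-}A$ and $\mathrm{FinLen}\text{-}R$ have CSL; (iii) $\mathrm{Mod}\text{-}A$ has CSL, but $\mathrm{Mod}\text{-}R$ does not. More precisely, for every algebraically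 closed field $K$ containing $k$, these properties hold for $R=K[x,x^{-1};\varphi]\otimes_k A$, where $\varphi\colon K\to K$, $a\mapsto a^{q}$, is the Frobenius automorphism and $K[x,x^{-1};\varphi]$ is the skew Laurent polynomial ring with $xa=\varphi(a)x$ for $a\in K$. -/

import Mathlib

open CategoryTheory TensorProduct

universe u

/-! ### Right modules, finite length, and the converse of Schur's lemma

Right `R`-modules are modules over the opposite ring `Rᵐᵒᵖ`. -/

/-- The category of right modules over `R`. -/
abbrev RightMod (R : Type u) [Ring R] : Type (u + 1) := ModuleCat.{u} Rᵐᵒᵖ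

/-- The class of right `R`-modules of finite length. -/
def isFinLen (R : Type u) [Ring R] : ObjectProperty (RightMod R) :=
  fun M => IsFiniteLength Rᵐᵒᵖ M

/-- The category of right `R`-modules of finite length, a full subcategory of `RightMod R`. -/
abbrev FinLen (R : Type u) [Ring R] : Type (u + 1) := (isFinLen R).FullSubcategory

/-- A ring is a division ring: `0 ≠ 1`, and every nonzero element is invertible. -/
def IsDivRing (E : Type*) [Ring E] : Prop :=
  Nontrivial E ∧ ∀ f : E, f ≠ 0 → IsUnit f

/-- The full subcategory of right `R`-modules given by a class `P` of modules satisfies the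
converse of Schur's lemma: each of its objects whose endomorphism ring is a division ring is
simple. -/
def HasCSL {R : Type u} [Ring R] (P : ObjectProperty (RightMod R)) : Prop :=
  ∀ M : RightMod R, P M → IsDivRing (Module.End Rᵐᵒᵖ M) → IsSimpleModule Rᵐᵒᵖ M

/-- The category of all right `R`-modules satisfies the converse of Schur's lemma. -/
def ModHasCSL (R : Type u) [Ring R] : Prop := HasCSL (⊤ : ObjectProperty (RightMod R))

/-- The category of right `R`-modules of finite length satisfies the converse of Schur's lemma. -/
def FinLenHasCSL (R : Type u) [Ring R] : Prop := HasCSL (isFinLen R)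

/-! ### The right Gabriel quiver -/

/-- Simple right `R`-modules. -/
def SimpleRightMod (R : Type u) [Ring R] : Type (u + 1) :=
  {S : RightMod R // IsSimpleModule Rᵐᵒᵖ S}

/-- Isomorphism of simple right modules. -/
def simpleRightModSetoid (R : Type u) [Ring R] : Setoid (SimpleRightMod R) where
  r S T := Nonempty (S.1 ≃ₗ[Rᵐᵒᵖ] T.1)
  iseqv :=
    { refl := fun S => ⟨LinearEquiv.refl _ S.1⟩
      symm := fun ⟨e⟩ => ⟨e.symm⟩
      trans := fun ⟨e⟩ ⟨f⟩ => ⟨e.trans f⟩ }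

/-- Points of the right Gabriel quiver: isomorphism classes of simple right modules. -/
def GabrielPoint (R : Type u) [Ring R] : Type (u + 1) := Quotient (simpleRightModSetoid R)

/-- The point of the right Gabriel quiver given by a simple right module. -/
def GabrielPoint.mk {R : Type u} [Ring R] (S : SimpleRightMod R) : GabrielPoint R :=
  Quotient.mk (simpleRightModSetoid R) S

/-- The right Gabriel quiver of `R`: there is an arrow `i → j` when `Ext¹(Sᵢ, Sⱼ) ≠ 0`
(representatives may be chosen arbitrarily, as `Ext¹` respects isomorphisms). -/
def gabrielQuiver (R : Type u) [Ring R] : Digraph (GabrielPoint R) where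
  Adj i j := ∃ S T : SimpleRightMod R, GabrielPoint.mk S = i ∧ GabrielPoint.mk T = j ∧
    Nontrivial (Abelian.Ext.{u} S.1 T.1 1)

/-- No arrows between two different points (loops are allowed). -/
def Digraph.TotallyDisconnected {V : Type*} (Q : Digraph V) : Prop :=
  ∀ i j : V, i ≠ j → ¬ Q.Adj i j

/-! ### Elementary algebras -/

/-- A finite-dimensional `k`-algebra `A` is elementary if `A / rad A` is isomorphic, as a
`k`-algebra, to a finite direct product of copies of `k`. -/
def IsElementary (k A : Type*) [Field k] [Ring A] [Algebra k A] : Prop :=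
  Module.Finite k A ∧ ∃ n : ℕ, Nonempty ((A ⧸ Ring.jacobson A) ≃ₐ[k] (Fin n → k))

/-! ### Skew Laurent polynomial rings -/

section SkewLaurent

variable {k K : Type u} [Field k] [Field K] [Algebra k K]

/-- The skew Laurent polynomial ring `K[x, x⁻¹; φ]`, for a `k`-automorphism `φ` of `K`: its
elements are the finite sums `∑ aᵢ xⁱ` (`i ∈ ℤ`, `aᵢ ∈ K`), multiplied by
`(a xⁱ) (b xʲ) = a φⁱ(b) xⁱ⁺ʲ`. It is the skew group ring of the infinite cyclic group
`⟨x⟩` over `K`, with `x` acting on `K` as `φ`. -/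
def SkewLaurent (_φ : K ≃ₐ[k] K) : Type u := SkewMonoidAlgebra K (Multiplicative ℤ)

namespace SkewLaurent

/-- The action of `⟨x⟩ ≅ ℤ` on `K` in which `x` acts as `φ`. -/
@[reducible] noncomputable def action (φ : K ≃ₐ[k] K) : MulSemiringAction (Multiplicative ℤ) K :=
  MulSemiringAction.compHom K (zpowersHom (K ≃ₐ[k] K) φ)

noncomputable instance (φ : K ≃ₐ[k] K) : Ring (SkewLaurent φ) :=
  letI := action φ
  inferInstanceAs (Ring (SkewMonoidAlgebra K (Multiplicative ℤ)))

/-- The monomial `a xⁱ`. -/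
noncomputable def monomial (φ : K ≃ₐ[k] K) (i : ℤ) (a : K) : SkewLaurent φ :=
  SkewMonoidAlgebra.single (Multiplicative.ofAdd i) a

theorem monomial_mul_monomial (φ : K ≃ₐ[k] K) (i j : ℤ) (a b : K) :
    monomial φ i a * monomial φ j b = monomial φ (i + j) (a * (φ ^ i) b) := by
  let _ := action φ
  exact SkewMonoidAlgebra.single_mul_single

theorem monomial_zero_one (φ : K ≃ₐ[k] K) : monomial φ 0 1 = 1 := rfl

theorem monomial_zero_right (φ : K ≃ₐ[k] K) (i : ℤ) : monomial φ i 0 = 0 :=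
  SkewMonoidAlgebra.single_zero _

theorem monomial_add (φ : K ≃ₐ[k] K) (i : ℤ) (a b : K) :
    monomial φ i (a + b) = monomial φ i a + monomial φ i b :=
  SkewMonoidAlgebra.single_add _ _ _

theorem induction_on {φ : K ≃ₐ[k] K} {p : SkewLaurent φ → Prop} (f : SkewLaurent φ)
    (zero : p 0) (mono : ∀ i a, p (monomial φ i a)) (add : ∀ f g, p f → p g → p (f + g)) :
    p f :=
  SkewMonoidAlgebra.induction_on (p := p) f zero (fun i a => mono i.toAdd a)
    (fun {_ _} hf hg => add _ _ hf hg)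

/-- The inclusion of `K` as the ring of constants. -/
noncomputable def C (φ : K ≃ₐ[k] K) : K →+* SkewLaurent φ where
  toFun := monomial φ 0
  map_one' := monomial_zero_one φ
  map_mul' a b := by simp [monomial_mul_monomial]
  map_zero' := monomial_zero_right φ 0
  map_add' := monomial_add φ 0

/-- `K[x, x⁻¹; φ]` is a `k`-algebra, since `φ` fixes `k`. -/
noncomputable instance (φ : K ≃ₐ[k] K) : Algebra k (SkewLaurent φ) :=
  ((C φ).comp (algebraMap k K)).toAlgebra' (by
    intro c f
    change monomial φ 0 (algebraMap k K c) * f = f * monomial φ 0 (algebraMap k K c)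
    induction f using induction_on with
    | zero => simp
    | mono i a => simp [monomial_mul_monomial, mul_comm]
    | add f g hf hg => rw [mul_add, add_mul, hf, hg])

end SkewLaurent

end SkewLaurent

/-- The ring `K[x, x⁻¹; φ]`, where `K` is an algebraically closed field containing the finite
field `k` of `q` elements and `φ` is the Frobenius automorphism `a ↦ a ^ q` of `K`. -/
abbrev CozzensRing (k K : Type u) [Field k] [Fintype k] [Field K] [IsAlgClosed K] [Algebra k K] :
    Type u :=
  SkewLaurent (FiniteField.frobeniusAlgEquiv k K (ringExpChar K))

universe v

/-!
Write `D = K[x, x⁻¹; φ]`, where `φ` is the `q`-Frobenius, and `J` for the radical of `A`.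

*Finite length.* The anti-automorphism of `D` that fixes `K` and inverts `x` turns right modules
over `D ⊗ A` into left modules over `D ⊗ B` with `B = Aᵐᵒᵖ`; such a module is a `K`-vector space with
a Frobenius-semilinear bijection `x` and a commuting action of `B`. Left ideals of `D` are principal,
and a generator is an additive polynomial in the Frobenius, so it kills a nonzero element of the
algebraically closed field `K`; hence `K`, with `x` acting as `φ`, is the only simple `D`-module
(`nonempty_linearEquiv_of_isSimpleModule`). A simple module over `D ⊗ B` is simple over `D`, because
`B` acts on it by scalars. As `t ^ q - t + c = 0` is solvable in `K`, a module of finite length is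
spanned over `K` by finitely many fixed points of `x` (`fixedSpanned_of_isFiniteLength`), and a
`k`-basis of the fixed points is a `K`-basis of the module (`linearIndependent_of_fixed`). So
`M ↦ {m | x m = m}` is an equivalence to the `B`-modules of finite length, with inverse
`V ↦ K ⊗ V` (`fixedPointsFunctor_isEquivalence`).

*The converse of Schur's lemma for `A`.* If `χ ≠ χ'` are characters of `A`, a `(χ, χ')`-derivation
`A → k` defines an extension of simple modules, which splits since the quiver has no arrows between
different points; so the derivation is inner (`derivation_eq_zero`). Hence `eᵢ A eⱼ ⊆ J²` for
different primitive idempotents, then `eᵢ A eⱼ ⊆ Jᴺ` for all `N`, so the `eᵢ` are central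
(`exists_central_idempotents`). If the endomorphism ring of `M` is a division ring, one `eᵢ` acts as
the identity, and a `k`-linear map from the top of `M` to its socle is an endomorphism, so it is zero
or bijective; this forces `M` to be one-dimensional (`NilpotentKer.isSimpleModule_of_isDivRing`). For
`D ⊗ A`, an endomorphism of a module of finite length is the same as one of its fixed points.

*Failure for all modules.* `D` is a noetherian domain, so it has a division ring of fractions `Q`.
Through a character of `A` this is a module over `D ⊗ A` with endomorphism ring `Q`, and `D` is a
proper submodule (`not_modHasCSL_of_fractions`).
-/

/-! ### Skew Laurent polynomials: coefficients, division and principal left ideals -/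

namespace SkewLaurent

section General

variable {k K : Type u} [Field k] [Field K] [Algebra k K] {φ : K ≃ₐ[k] K}

/-- The coefficient of `xⁱ`, with coefficients written on the left. -/
noncomputable def coeff (f : SkewLaurent φ) (i : ℤ) : K :=
  SkewMonoidAlgebra.coeff f (Multiplicative.ofAdd i)

theorem ext_coeff {f g : SkewLaurent φ} (h : ∀ i, coeff f i = coeff g i) : f = g :=
  SkewMonoidAlgebra.ext fun a => h a.toAdd

@[simp] theorem coeff_zero (i : ℤ) : coeff (0 : SkewLaurent φ) i = 0 := by
  change SkewMonoidAlgebra.coeff (0 : SkewMonoidAlgebra K (Multiplicative ℤ)) _ = 0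
  simp

@[simp] theorem coeff_add (f g : SkewLaurent φ) (i : ℤ) :
    coeff (f + g) i = coeff f i + coeff g i := by
  exact DFunLike.congr_fun (SkewMonoidAlgebra.coeff_add (k := K) (G := Multiplicative ℤ) f g) _

theorem coeff_monomial (i j : ℤ) (a : K) :
    coeff (monomial φ i a) j = if i = j then a else 0 := by
  classical
  refine SkewMonoidAlgebra.coeff_single_apply.trans ?_
  simp

theorem coeff_monomial_mul (i : ℤ) (a : K) (f : SkewLaurent φ) (j : ℤ) :
    coeff (monomial φ i a * f) j = a * (φ ^ i) (coeff f (j - i)) := by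
  let _ := action φ
  refine (SkewMonoidAlgebra.coeff_single_mul (k := K) (G := Multiplicative ℤ) a
    (Multiplicative.ofAdd i) f (Multiplicative.ofAdd j)).trans ?_
  have : (Multiplicative.ofAdd i)⁻¹ * Multiplicative.ofAdd j = Multiplicative.ofAdd (j - i) := by
    rw [← ofAdd_neg, ← ofAdd_add, neg_add_eq_sub]
  rw [this]
  rfl

/-- Taking a coefficient is additive. -/
noncomputable def coeffHom (φ : K ≃ₐ[k] K) (i : ℤ) : SkewLaurent φ →+ K where
  toFun f := coeff f i
  map_zero' := coeff_zero i
  map_add' f g := coeff_add f g i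

theorem coeff_sub (f g : SkewLaurent φ) (i : ℤ) : coeff (f - g) i = coeff f i - coeff g i :=
  map_sub (coeffHom φ i) f g

theorem coeff_sum {ι : Type*} (s : Finset ι) (f : ι → SkewLaurent φ) (i : ℤ) :
    coeff (∑ l ∈ s, f l) i = ∑ l ∈ s, coeff (f l) i :=
  map_sum (coeffHom φ i) f s

/-- `f` is a polynomial in `x` of degree less than `n`: its exponents lie in `[0, n)`. -/
def DegreeLT (f : SkewLaurent φ) (n : ℕ) : Prop :=
  ∀ i : ℤ, coeff f i ≠ 0 → 0 ≤ i ∧ i < n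

theorem exists_coeff_bound (f : SkewLaurent φ) :
    ∃ N : ℕ, ∀ i : ℤ, coeff f i ≠ 0 → -(N : ℤ) ≤ i ∧ i < N := by
  induction f using induction_on with
  | zero => exact ⟨0, fun i hi => absurd (coeff_zero i) hi⟩
  | mono i a =>
    refine ⟨i.natAbs + 1, fun j hj => ?_⟩
    have : i = j := by
      by_contra h
      exact hj (by rw [coeff_monomial, if_neg h])
    omega
  | add f g hf hg =>
    obtain ⟨N, hN⟩ := hf
    obtain ⟨N', hN'⟩ := hg
    refine ⟨max N N', fun j hj => ?_⟩
    have : coeff f j ≠ 0 ∨ coeff g j ≠ 0 := by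
      by_contra! h
      exact hj (by rw [coeff_add, h.1, h.2, add_zero])
    rcases this with h | h
    · have := hN j h
      push_cast
      omega
    · have := hN' j h
      push_cast
      omega

theorem exists_degreeLT_monomial_mul (f : SkewLaurent φ) :
    ∃ N n : ℕ, DegreeLT (monomial φ N 1 * f) n := by
  obtain ⟨N, hN⟩ := exists_coeff_bound f
  refine ⟨N, 2 * N, fun i hi => ?_⟩
  rw [coeff_monomial_mul, one_mul] at hi
  have := hN (i - N) fun h => hi (by rw [h, map_zero])
  push_cast
  omega

theorem monomial_neg_mul_monomial_mul (i : ℤ) (f : SkewLaurent φ) :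
    monomial φ (-i) 1 * (monomial φ i 1 * f) = f := by
  rw [← mul_assoc, monomial_mul_monomial, neg_add_cancel, map_one, mul_one, monomial_zero_one,
    one_mul]

theorem DegreeLT.eq_zero {f : SkewLaurent φ} (hf : DegreeLT f 0) : f = 0 :=
  ext_coeff fun i => by
    by_contra h
    rw [coeff_zero] at h
    have := hf i h
    omega

theorem DegreeLT.eq_sum {f : SkewLaurent φ} {n : ℕ} (hf : DegreeLT f n) :
    f = ∑ i ∈ Finset.range n, monomial φ i (coeff f i) := by
  refine ext_coeff fun j => ?_
  rw [coeff_sum]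
  simp_rw [coeff_monomial]
  by_cases hj : coeff f j = 0
  · rw [hj, Finset.sum_eq_zero]
    intro i _
    split_ifs with h
    · rw [h, hj]
    · rfl
  · obtain ⟨h0, h1⟩ := hf j hj
    lift j to ℕ using h0
    rw [Finset.sum_eq_single j]
    · simp
    · intro i _ hi
      rw [if_neg (by exact_mod_cast hi)]
    · intro h
      exact absurd (Finset.mem_range.2 (by exact_mod_cast h1)) h

/-- Every nonzero left ideal is generated by a polynomial in `x` of some degree `n` with nonzero
constant coefficient: any nonzero element of least possible degree will do, by division with
remainder. -/
theorem exists_generator (I : Submodule (SkewLaurent φ) (SkewLaurent φ)) (hI : I ≠ ⊥) :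
    ∃ (f : SkewLaurent φ) (n : ℕ), DegreeLT f (n + 1) ∧ coeff f 0 ≠ 0 ∧ coeff f n ≠ 0 ∧
      I = Submodule.span (SkewLaurent φ) {f} := by
  classical
  have hex : ∃ n : ℕ, ∃ f ∈ I, f ≠ 0 ∧ DegreeLT f n := by
    obtain ⟨g, hg, hg0⟩ := Submodule.exists_mem_ne_zero_of_ne_bot hI
    obtain ⟨N, n, h⟩ := exists_degreeLT_monomial_mul g
    refine ⟨n, _, I.smul_mem (monomial φ N 1) hg, fun h0 => hg0 ?_, h⟩
    rw [← monomial_neg_mul_monomial_mul (N : ℤ) g]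
    rw [smul_eq_mul] at h0
    rw [h0, mul_zero]
  obtain ⟨f, hfI, hf0, hf⟩ := Nat.find_spec hex
  have hmin : ∀ m < Nat.find hex, ∀ g ∈ I, DegreeLT g m → g = 0 := by
    intro m hm g hg hgm
    by_contra h
    exact Nat.find_min hex hm ⟨g, hg, h, hgm⟩
  obtain ⟨n, hn⟩ : ∃ n, Nat.find hex = n + 1 := by
    refine Nat.exists_eq_succ_of_ne_zero fun h => hf0 ?_
    rw [h] at hf
    exact hf.eq_zero
  rw [hn] at hf hmin
  have htop : coeff f n ≠ 0 := by
    intro h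
    refine hf0 (hmin n n.lt_succ_self f hfI fun i hi => ?_)
    have := hf i hi
    have : i ≠ n := fun h' => hi (h' ▸ h)
    push_cast at *
    omega
  have hbot : coeff f 0 ≠ 0 := by
    intro h
    have h0 := hmin n n.lt_succ_self _ (I.smul_mem (monomial φ (-1) 1) hfI) fun i hi => by
      rw [smul_eq_mul, coeff_monomial_mul, one_mul] at hi
      have h1 : coeff f (i - -1) ≠ 0 := fun h => hi (by rw [h, map_zero])
      have := hf _ h1
      have : i - -1 ≠ 0 := fun h' => h1 (h' ▸ h)
      push_cast at *
      omega
    refine hf0 ?_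
    rw [← monomial_neg_mul_monomial_mul (-1) f]
    rw [smul_eq_mul] at h0
    rw [h0, mul_zero]
  have hdiv : ∀ N : ℕ, ∀ g ∈ I, DegreeLT g N → g ∈ Submodule.span (SkewLaurent φ) {f} := by
    intro N
    induction N with
    | zero =>
      intro g _ hg
      rw [hg.eq_zero]
      exact zero_mem _
    | succ N ih =>
      intro g hgI hg
      by_cases hN : N < n
      · rw [hmin (N + 1) (by omega) g hgI hg]
        exact zero_mem _
      -- subtract the left multiple of `f` with the same leading term as `g`
      set b : K := coeff g N / (φ ^ ((N : ℤ) - n)) (coeff f n) with hb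
      have hmul : monomial φ ((N : ℤ) - n) b * f ∈ Submodule.span (SkewLaurent φ) {f} :=
        Submodule.smul_mem _ _ (Submodule.mem_span_singleton_self f)
      have hsub : g - monomial φ ((N : ℤ) - n) b * f ∈ Submodule.span (SkewLaurent φ) {f} := by
        refine ih _ (sub_mem hgI (I.smul_mem _ hfI)) fun i hi => ?_
        rw [coeff_sub, coeff_monomial_mul] at hi
        have hiN : i ≠ N := by
          rintro rfl
          apply hi
          have : (φ ^ ((N : ℤ) - n)) (coeff f n) ≠ 0 := by simpa using htop
          rw [sub_sub_cancel, hb, div_mul_cancel₀ _ this, sub_self]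
        have : coeff g i ≠ 0 ∨ coeff f (i - (N - n)) ≠ 0 := by
          by_contra! h
          exact hi (by rw [h.1, h.2, map_zero, mul_zero, sub_zero])
        rcases this with h | h
        · have := hg i h
          push_cast at *
          omega
        · have := hf _ h
          push_cast at *
          omega
      have := add_mem hsub hmul
      rwa [sub_add_cancel] at this
  refine ⟨f, n, hf, hbot, htop, le_antisymm (fun g hg => ?_) ?_⟩
  · obtain ⟨N, m, h⟩ := exists_degreeLT_monomial_mul g
    have := hdiv m _ (I.smul_mem (monomial φ N 1) hg) h
    rw [← monomial_neg_mul_monomial_mul (N : ℤ) g]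
    exact Submodule.smul_mem _ _ this
  · rw [Submodule.span_singleton_le_iff_mem]
    exact hfI

instance : IsPrincipalIdealRing (SkewLaurent φ) where
  principal I := by
    by_cases hI : I = ⊥
    · rw [hI]
      infer_instance
    · obtain ⟨f, _, _, _, _, h⟩ := exists_generator I hI
      exact ⟨f, h⟩

instance : IsNoetherianRing (SkewLaurent φ) := inferInstance

instance : Nontrivial (SkewLaurent φ) :=
  inferInstanceAs (Nontrivial (SkewMonoidAlgebra K (Multiplicative ℤ)))

instance : NoZeroDivisors (SkewLaurent φ) where
  eq_zero_or_eq_zero_of_mul_eq_zero {f g} hfg := by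
    classical
    let _ := action φ
    change SkewMonoidAlgebra K (Multiplicative ℤ) at f g
    by_contra! h
    have hf : f.support.Nonempty := by
      rw [Finset.nonempty_iff_ne_empty, Ne, SkewMonoidAlgebra.support_eq_empty]
      exact h.1
    have hg : g.support.Nonempty := by
      rw [Finset.nonempty_iff_ne_empty, Ne, SkewMonoidAlgebra.support_eq_empty]
      exact h.2
    obtain ⟨a, ha, b, hb, hu⟩ := UniqueProds.uniqueMul_of_nonempty hf hg
    have h1 : SkewMonoidAlgebra.coeff (f * g) (a * b) = 0 := by
      have : f * g = 0 := hfg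
      rw [this]
      simp
    rw [SkewMonoidAlgebra.coeff_mul, SkewMonoidAlgebra.sum_def', Finset.sum_eq_single a,
      SkewMonoidAlgebra.sum_def', Finset.sum_eq_single b, if_pos rfl] at h1
    · rcases mul_eq_zero.1 h1 with h1 | h1
      · exact SkewMonoidAlgebra.mem_support_iff.1 ha h1
      · rw [smul_eq_zero_iff_eq] at h1
        exact SkewMonoidAlgebra.mem_support_iff.1 hb h1
    · intro b' hb' hne
      rw [if_neg]
      intro h'
      exact hne (hu ha hb' h').2
    · intro h'
      exact absurd hb h'
    · intro a' ha' hne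
      rw [SkewMonoidAlgebra.sum_def']
      refine Finset.sum_eq_zero fun b' hb' => ?_
      rw [if_neg]
      intro h'
      exact hne (hu ha' hb' h').1
    · intro h'
      exact absurd ha h'

instance : IsDomain (SkewLaurent φ) := NoZeroDivisors.to_isDomain _

/-! ### Homomorphisms out of a skew Laurent polynomial ring -/

/-- The generator `x`, as a unit. -/
noncomputable def X (φ : K ≃ₐ[k] K) : (SkewLaurent φ)ˣ where
  val := monomial φ 1 1
  inv := monomial φ (-1) 1
  val_inv := by rw [monomial_mul_monomial]; simp [monomial_zero_one]
  inv_val := by rw [monomial_mul_monomial]; simp [monomial_zero_one]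

theorem X_mul_C (a : K) : (X φ : SkewLaurent φ) * C φ a = C φ (φ a) * X φ := by
  change monomial φ 1 1 * monomial φ 0 a = monomial φ 0 (φ a) * monomial φ 1 1
  simp [monomial_mul_monomial]

theorem X_zpow (i : ℤ) : ((X φ ^ i : (SkewLaurent φ)ˣ) : SkewLaurent φ) = monomial φ i 1 := by
  induction i with
  | zero => rfl
  | succ i ih =>
    rw [zpow_add_one, Units.val_mul, ih]
    change _ * monomial φ 1 1 = _
    simp [monomial_mul_monomial]
  | pred i ih =>
    rw [zpow_sub_one, Units.val_mul, ih]
    change _ * monomial φ (-1) 1 = _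
    simp [monomial_mul_monomial, sub_eq_add_neg]

theorem monomial_eq (i : ℤ) (a : K) :
    monomial φ i a = C φ a * ((X φ ^ i : (SkewLaurent φ)ˣ) : SkewLaurent φ) := by
  rw [X_zpow]
  change _ = monomial φ 0 a * _
  simp [monomial_mul_monomial]

theorem units_zpow_mul {S : Type*} [Ring S] (f : K →+* S) (v : Sˣ)
    (h : ∀ a, v * f a = f (φ a) * v) (i : ℤ) (a : K) :
    ((v ^ i : Sˣ) : S) * f a = f ((φ ^ i) a) * (v ^ i : Sˣ) := by
  have hinv : ∀ a, ((v⁻¹ : Sˣ) : S) * f a = f (φ.symm a) * (v⁻¹ : Sˣ) := fun a => by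
    rw [Units.inv_mul_eq_iff_eq_mul, ← mul_assoc, h, AlgEquiv.apply_symm_apply, mul_assoc,
      Units.mul_inv, mul_one]
  induction i generalizing a with
  | zero => simp
  | succ i ih =>
    rw [zpow_add_one, Units.val_mul, mul_assoc, h, ← mul_assoc, ih, mul_assoc, zpow_add_one]
    rfl
  | pred i ih =>
    rw [zpow_sub_one, Units.val_mul, mul_assoc, hinv, ← mul_assoc, ih, mul_assoc, zpow_sub_one]
    rfl

/-- The universal property: a ring homomorphism from `K[x, x⁻¹; φ]` is given by one from `K` and
a unit, the image of `x`, with the commutation rule of `x`. -/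
noncomputable def lift {S : Type*} [Ring S] (f : K →+* S) (v : Sˣ)
    (h : ∀ a, v * f a = f (φ a) * v) : SkewLaurent φ →+* S :=
  letI := action φ
  SkewMonoidAlgebra.liftNCRingHom (k := K) (G := Multiplicative ℤ) f
    ((Units.coeHom S).comp (zpowersHom Sˣ v))
    (fun {a i} => (units_zpow_mul f v h i.toAdd a).symm)

theorem lift_monomial {S : Type*} [Ring S] (f : K →+* S) (v : Sˣ)
    (h : ∀ a, v * f a = f (φ a) * v) (i : ℤ) (a : K) :
    lift f v h (monomial φ i a) = f a * (v ^ i : Sˣ) :=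
  SkewMonoidAlgebra.liftNC_single _ _ _ _

theorem lift_C {S : Type*} [Ring S] (f : K →+* S) (v : Sˣ)
    (h : ∀ a, v * f a = f (φ a) * v) (a : K) : lift f v h (C φ a) = f a :=
  (lift_monomial f v h 0 a).trans (by simp)

theorem lift_X {S : Type*} [Ring S] (f : K →+* S) (v : Sˣ)
    (h : ∀ a, v * f a = f (φ a) * v) : lift f v h (X φ) = v :=
  (lift_monomial f v h 1 1).trans (by simp)

/-- The inclusion of `K` in the opposite of `K[x, x⁻¹; φ]`. -/
noncomputable def opC (φ : K ≃ₐ[k] K) : K →+* (SkewLaurent φ)ᵐᵒᵖ :=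
  (C φ).toOpposite fun a b => by rw [Commute, SemiconjBy, ← map_mul, ← map_mul, mul_comm]

theorem opC_apply (a : K) : opC φ a = .op (C φ a) := rfl

/-- The inverse of `x`, as a unit of the opposite ring. -/
noncomputable def opXInv (φ : K ≃ₐ[k] K) : (SkewLaurent φ)ᵐᵒᵖˣ :=
  Units.opEquiv.symm (.op (X φ)⁻¹)

theorem opXInv_val : (opXInv φ : (SkewLaurent φ)ᵐᵒᵖ) = .op ((X φ)⁻¹ : (SkewLaurent φ)ˣ) := rfl

theorem opXInv_mul_opC (a : K) :
    (opXInv φ : (SkewLaurent φ)ᵐᵒᵖ) * opC φ a = opC φ (φ a) * opXInv φ := by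
  apply MulOpposite.unop_injective
  change C φ a * ((X φ)⁻¹ : (SkewLaurent φ)ˣ) = ((X φ)⁻¹ : (SkewLaurent φ)ˣ) * C φ (φ a)
  rw [Units.eq_inv_mul_iff_mul_eq, ← mul_assoc, X_mul_C, mul_assoc, Units.mul_inv, mul_one]

/-- The anti-homomorphism of `K[x, x⁻¹; φ]` to itself that fixes `K` and inverts `x`. -/
noncomputable def toOp (φ : K ≃ₐ[k] K) : SkewLaurent φ →+* (SkewLaurent φ)ᵐᵒᵖ :=
  lift (opC φ) (opXInv φ) opXInv_mul_opC

theorem toOp_C (a : K) : toOp φ (C φ a) = .op (C φ a) := by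
  rw [toOp, lift_C, opC_apply]

theorem toOp_X : toOp φ (X φ) = .op ((X φ)⁻¹ : (SkewLaurent φ)ˣ) := by
  rw [toOp, lift_X, opXInv_val]

theorem ringHom_ext {S : Type*} [Ring S] {f g : SkewLaurent φ →+* S}
    (hC : ∀ a, f (C φ a) = g (C φ a)) (hX : f (X φ) = g (X φ)) : f = g := by
  have hu : Units.map (f : SkewLaurent φ →* S) (X φ) = Units.map (g : SkewLaurent φ →* S) (X φ) :=
    Units.ext hX
  ext p
  induction p using induction_on with
  | zero => simp
  | mono i a =>
    have := congrArg (fun v : Sˣ => ((v ^ i : Sˣ) : S)) hu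
    simp only [← map_zpow, Units.coe_map] at this
    rw [monomial_eq, map_mul, map_mul, hC]
    exact congrArg _ this
  | add p q hp hq => rw [map_add, map_add, hp, hq]

theorem unop_toOp_unop_toOp (f : SkewLaurent φ) : (toOp φ (toOp φ f).unop).unop = f := by
  have : (toOp φ).op.comp (toOp φ) = (RingEquiv.opOp (SkewLaurent φ)).toRingHom := by
    refine ringHom_ext (fun a => ?_) ?_
    · simp [toOp_C]
    · have h : toOp φ ((X φ)⁻¹ : (SkewLaurent φ)ˣ) = .op (X φ : SkewLaurent φ) := by
        have h1 := congrArg (toOp φ) (X φ).mul_inv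
        rw [map_mul, map_one, toOp_X] at h1
        have h2 := congrArg MulOpposite.unop h1
        rw [MulOpposite.unop_mul, MulOpposite.unop_op, MulOpposite.unop_one, Units.mul_inv_eq_one]
          at h2
        rw [← h2, MulOpposite.op_unop]
      simp [toOp_X, h]
  exact congrArg (fun f => f.unop.unop) (RingHom.congr_fun this f)

/-- `K[x, x⁻¹; φ]` is isomorphic to its opposite, by the map that fixes `K` and inverts `x`. -/
noncomputable def opEquiv (φ : K ≃ₐ[k] K) : SkewLaurent φ ≃ₐ[k] (SkewLaurent φ)ᵐᵒᵖ :=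
  AlgEquiv.ofBijective { toOp φ with commutes' := fun c => toOp_C (algebraMap k K c) }
    ⟨fun f g h => by
      rw [← unop_toOp_unop_toOp f, ← unop_toOp_unop_toOp g]
      exact congrArg (fun p => (toOp φ (MulOpposite.unop p)).unop) h,
    fun f => ⟨(toOp φ f.unop).unop, MulOpposite.unop_injective (unop_toOp_unop_toOp f.unop)⟩⟩

end General

end SkewLaurent

/-! ### The module `K`, on which `x` acts as `φ` -/

namespace SkewLaurent

section General

variable {k K : Type u} [Field k] [Field K] [Algebra k K] {φ : K ≃ₐ[k] K}

/-- The automorphism `φ` as a unit of the ring of `k`-linear endomorphisms of `K`. -/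
noncomputable def endUnit (φ : K ≃ₐ[k] K) : (Module.End k K)ˣ :=
  (LinearMap.GeneralLinearGroup.generalLinearEquiv k K).symm φ.toLinearEquiv

theorem endUnit_mul_lmul (a : K) :
    (endUnit φ : Module.End k K) * Algebra.lmul k K a = Algebra.lmul k K (φ a) * endUnit φ :=
  LinearMap.ext fun c => map_mul φ a c

/-- The action of `K[x, x⁻¹; φ]` on `K` in which `K` acts by multiplication and `x` as `φ`. -/
noncomputable def act (φ : K ≃ₐ[k] K) : SkewLaurent φ →ₐ[k] Module.End k K :=
  { lift (Algebra.lmul k K).toRingHom (endUnit φ) endUnit_mul_lmul with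
    commutes' := fun c => (lift_C (Algebra.lmul k K).toRingHom (endUnit φ) endUnit_mul_lmul
      (algebraMap k K c)).trans ((Algebra.lmul k K).commutes c) }

theorem act_C (a c : K) : act φ (C φ a) c = a * c :=
  LinearMap.congr_fun (lift_C (Algebra.lmul k K).toRingHom (endUnit φ) endUnit_mul_lmul a) c

theorem act_X (c : K) : act φ (X φ) c = φ c :=
  LinearMap.congr_fun (lift_X (Algebra.lmul k K).toRingHom (endUnit φ) endUnit_mul_lmul) c

theorem endUnit_zpow_apply (i : ℤ) (c : K) :
    ((endUnit φ ^ i : (Module.End k K)ˣ) : Module.End k K) c = (φ ^ i) c := by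
  induction i generalizing c with
  | zero => rfl
  | succ i ih =>
    rw [zpow_add_one, Units.val_mul, Module.End.mul_apply, ih, zpow_add_one]
    rfl
  | pred i ih =>
    rw [zpow_sub_one, Units.val_mul, Module.End.mul_apply, ih, zpow_sub_one]
    rfl

theorem act_monomial (i : ℤ) (a c : K) : act φ (monomial φ i a) c = a * (φ ^ i) c := by
  refine (LinearMap.congr_fun (lift_monomial (Algebra.lmul k K).toRingHom (endUnit φ)
    endUnit_mul_lmul i a) c).trans ?_
  rw [Module.End.mul_apply, endUnit_zpow_apply]
  rfl

noncomputable instance : Module (SkewLaurent φ) K := Module.compHom K (act φ).toRingHom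

theorem smul_def (f : SkewLaurent φ) (c : K) : f • c = act φ f c := rfl

theorem X_ne_one : (X φ : SkewLaurent φ) ≠ 1 := fun h => by
  have h1 := congrArg (fun f => coeff f 0) h
  change coeff (monomial φ 1 1) 0 = coeff (monomial φ 0 1) 0 at h1
  rw [coeff_monomial, coeff_monomial, if_neg one_ne_zero, if_pos rfl] at h1
  exact zero_ne_one h1

/-- `x - 1` is not left invertible, since it kills `1` in the module `K`. -/
theorem mul_X_sub_one_ne_one (f : SkewLaurent φ) : f * ((X φ : SkewLaurent φ) - 1) ≠ 1 := by
  intro h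
  have h1 := congrArg (fun p => p • (1 : K)) h
  simp only [mul_smul, sub_smul, one_smul, smul_def (X φ : SkewLaurent φ), act_X, map_one, sub_self,
    smul_zero] at h1
  exact zero_ne_one h1

theorem not_isSimpleModule_self : ¬ IsSimpleModule (SkewLaurent φ) (SkewLaurent φ) := by
  intro h
  rcases eq_bot_or_eq_top (Submodule.span (SkewLaurent φ) {(X φ : SkewLaurent φ) - 1}) with h | h
  · rw [Submodule.span_singleton_eq_bot, sub_eq_zero] at h
    exact X_ne_one h
  · have : (1 : SkewLaurent φ) ∈ Submodule.span (SkewLaurent φ) {(X φ : SkewLaurent φ) - 1} := by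
      rw [h]
      trivial
    obtain ⟨f, hf⟩ := Submodule.mem_span_singleton.1 this
    exact mul_X_sub_one_ne_one f hf

end General

/-! ### Equations in the Frobenius of an algebraically closed field -/

section Frobenius

variable {k K : Type u} [Field k] [Fintype k] [Field K] [Algebra k K]

theorem mem_range_algebraMap_of_pow_card_eq {a : K} (ha : a ^ Fintype.card k = a) :
    a ∈ (algebraMap k K).range := by
  classical
  have hp := FiniteField.X_pow_card_sub_X_ne_zero K (Fintype.one_lt_card (α := k))
  have hroots : ((Polynomial.X ^ Fintype.card k - Polynomial.X : Polynomial k).map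
      (algebraMap k K)).roots = Finset.univ.val.map (algebraMap k K) := by
    rw [← FiniteField.roots_X_pow_card_sub_X k]
    refine (Polynomial.roots_map_of_injective_of_card_eq_natDegree (algebraMap k K).injective ?_
      ).symm
    rw [FiniteField.roots_X_pow_card_sub_X k,
      FiniteField.X_pow_card_sub_X_natDegree_eq k Fintype.one_lt_card]
    rfl
  have hmem : a ∈ ((Polynomial.X ^ Fintype.card k - Polynomial.X : Polynomial k).map
      (algebraMap k K)).roots := by
    rw [Polynomial.map_sub, Polynomial.map_pow, Polynomial.map_X, Polynomial.mem_roots hp]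
    simp [ha]
  rw [hroots, Multiset.mem_map] at hmem
  obtain ⟨c, _, hc⟩ := hmem
  exact ⟨c, hc⟩

variable [IsAlgClosed K]

/-- The Artin–Schreier equation for the `q`-Frobenius is solvable. -/
theorem exists_pow_card_eq_sub (k : Type u) [Field k] [Fintype k] (c : K) :
    ∃ t : K, t ^ Fintype.card k - t + c = 0 := by
  have hdeg : (Polynomial.X ^ Fintype.card k - Polynomial.X + Polynomial.C c).natDegree =
      Fintype.card k := by
    rw [Polynomial.natDegree_add_C,
      FiniteField.X_pow_card_sub_X_natDegree_eq K Fintype.one_lt_card]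
  obtain ⟨t, ht⟩ := IsAlgClosed.exists_root
    (Polynomial.X ^ Fintype.card k - Polynomial.X + Polynomial.C c) (fun h => by
      have := Polynomial.natDegree_eq_of_degree_eq_some h
      rw [hdeg] at this
      exact Fintype.card_ne_zero this)
  exact ⟨t, by simpa [Polynomial.IsRoot] using ht⟩

end Frobenius

section Frobenius

variable {k K : Type u} [Field k] [Fintype k] [Field K] [Algebra k K]
  {φ : K ≃ₐ[k] K}

theorem zpow_natCast_apply (hφ : ∀ a, φ a = a ^ Fintype.card k) (i : ℕ) (a : K) :
    (φ ^ (i : ℤ)) a = a ^ Fintype.card k ^ i := by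
  rw [zpow_natCast]
  induction i generalizing a with
  | zero => simp
  | succ i ih => rw [pow_succ, AlgEquiv.mul_apply, ih, hφ, ← pow_mul, pow_succ']

/-- A polynomial in the Frobenius with nonzero constant coefficient and positive degree kills a
nonzero element of an algebraically closed field. -/
theorem exists_smul_eq_zero [IsAlgClosed K] (hφ : ∀ a, φ a = a ^ Fintype.card k)
    {f : SkewLaurent φ} {n : ℕ}
    (hf : DegreeLT f (n + 1)) (h0 : coeff f 0 ≠ 0) (hn : coeff f n ≠ 0) (hn0 : n ≠ 0) :
    ∃ c : K, c ≠ 0 ∧ f • c = 0 := by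
  set q := Fintype.card k with hq
  have hq1 : 1 < q := Fintype.one_lt_card
  have hqpos : ∀ i, 1 ≤ q ^ i := fun i => Nat.one_le_pow _ _ (by omega)
  -- `f • c = ∑ aᵢ c ^ qⁱ`; divide by `c`
  let r : Polynomial K :=
    ∑ i ∈ Finset.range (n + 1), Polynomial.monomial (q ^ i - 1) (coeff f i)
  have hcoeff : ∀ i < n + 1, r.coeff (q ^ i - 1) = coeff f i := by
    intro i hi
    rw [Polynomial.finsetSum_coeff, Finset.sum_eq_single i]
    · rw [Polynomial.coeff_monomial, if_pos rfl]
    · intro j _ hj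
      rw [Polynomial.coeff_monomial, if_neg]
      intro h
      refine hj (Nat.pow_right_injective hq1 ?_)
      have := hqpos i
      have := hqpos j
      simp only
      omega
    · intro h
      exact absurd (Finset.mem_range.2 hi) h
  have hdeg : r.degree ≠ 0 := by
    intro h
    have h1 := Polynomial.eq_C_of_degree_eq_zero h
    have h2 := hcoeff n (by omega)
    have h3 : 1 < q ^ n := Nat.one_lt_pow hn0 hq1
    rw [h1, Polynomial.coeff_C, if_neg (by omega)] at h2
    exact hn h2.symm
  obtain ⟨c, hc⟩ := IsAlgClosed.exists_root r hdeg
  refine ⟨c, ?_, ?_⟩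
  · rintro rfl
    have h1 := hcoeff 0 (by omega)
    rw [pow_zero, Nat.sub_self, Polynomial.coeff_zero_eq_eval_zero, hc] at h1
    exact h0 h1.symm
  · have h1 : f • c = c * r.eval c := by
      conv_lhs => rw [hf.eq_sum]
      rw [Finset.sum_smul, Polynomial.eval_finsetSum, Finset.mul_sum]
      refine Finset.sum_congr rfl fun i _ => ?_
      rw [smul_def, act_monomial, zpow_natCast_apply hφ, Polynomial.eval_monomial, mul_left_comm,
        ← pow_succ', Nat.sub_add_cancel (hqpos i)]
    rw [h1, hc, mul_zero]

/-- Up to isomorphism, `K` is the only simple module over `K[x, x⁻¹; φ]`. The annihilator of a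
generator is the left ideal of a polynomial in the Frobenius, and this kills a nonzero element of
`K`. -/
theorem nonempty_linearEquiv_of_isSimpleModule [IsAlgClosed K]
    (hφ : ∀ a, φ a = a ^ Fintype.card k) (S : Type v)
    [AddCommGroup S] [Module (SkewLaurent φ) S] [IsSimpleModule (SkewLaurent φ) S] :
    Nonempty (S ≃ₗ[SkewLaurent φ] K) := by
  have := IsSimpleModule.nontrivial (SkewLaurent φ) S
  obtain ⟨m, hm⟩ := exists_ne (0 : S)
  set p := LinearMap.toSpanSingleton (SkewLaurent φ) S m with hp
  have hsurj : Function.Surjective p := IsSimpleModule.toSpanSingleton_surjective _ hm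
  have hbot : LinearMap.ker p ≠ ⊥ := fun h =>
    not_isSimpleModule_self (φ := φ)
      (IsSimpleModule.congr (LinearEquiv.ofBijective p ⟨LinearMap.ker_eq_bot.1 h, hsurj⟩))
  obtain ⟨f, n, hf, h0, hn, hker⟩ := exists_generator _ hbot
  have hfm : f • m = 0 := by
    have : f ∈ LinearMap.ker p := by
      rw [hker]
      exact Submodule.mem_span_singleton_self f
    simpa [hp] using this
  have hn0 : n ≠ 0 := by
    rintro rfl
    have h1 := hf.eq_sum
    rw [zero_add, Finset.sum_range_one] at h1
    have h2 : monomial φ 0 (coeff f 0)⁻¹ * f = 1 := by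
      rw [Nat.cast_zero] at h1
      nth_rw 2 [h1]
      rw [monomial_mul_monomial, zpow_zero, AlgEquiv.one_apply, inv_mul_cancel₀ h0, add_zero,
        monomial_zero_one]
    refine hm ?_
    rw [← one_smul (SkewLaurent φ) m, ← h2, mul_smul, hfm, smul_zero]
  obtain ⟨c, hc, hfc⟩ := exists_smul_eq_zero hφ hf h0 hn hn0
  have hle : LinearMap.ker p ≤ LinearMap.ker (LinearMap.toSpanSingleton (SkewLaurent φ) K c) := by
    rw [hker, Submodule.span_singleton_le_iff_mem]
    simpa using hfc
  let g : S →ₗ[SkewLaurent φ] K := ((LinearMap.ker p).liftQ _ hle).comp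
    (p.quotKerEquivOfSurjective hsurj).symm.toLinearMap
  have hg : g m = c := by
    have : (p.quotKerEquivOfSurjective hsurj).symm m = Submodule.Quotient.mk 1 := by
      rw [LinearEquiv.symm_apply_eq]
      simp [hp]
    simp only [g, LinearMap.comp_apply, LinearEquiv.coe_coe, this]
    refine ((LinearMap.ker p).liftQ_apply _ _).trans ?_
    simp
  refine ⟨LinearEquiv.ofBijective g ⟨?_, fun a => ⟨C φ (a / c) • m, ?_⟩⟩⟩
  · refine (LinearMap.injective_or_eq_zero g).resolve_right fun h => hc ?_
    rw [← hg, h, LinearMap.zero_apply]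
  · rw [map_smul, hg, smul_def, act_C, div_mul_cancel₀ _ hc]

/-! ### Vector spaces with a Frobenius-semilinear map -/

section Semilinear

variable {V : Type v} [AddCommGroup V] [Module K V] {F : V →+ V}

/-- Fixed vectors of a Frobenius-semilinear map that are independent over `k` are independent over
`K`: in a dependence relation of least length with a coefficient `1`, all coefficients are fixed by
the Frobenius. -/
theorem linearIndependent_of_fixed [Module k V] [IsScalarTower k K V]
    (hF : ∀ (c : K) v, F (c • v) = c ^ Fintype.card k • F v) {ι : Type*} {b : ι → V}
    (hb : LinearIndependent k b) (hfix : ∀ i, F (b i) = b i) : LinearIndependent K b := by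
  classical
  rw [linearIndependent_iff']
  intro s
  induction s using Finset.induction with
  | empty => simp
  | insert a s ha ih =>
    intro g hg
    by_cases hga : g a = 0
    · rw [Finset.sum_insert ha, hga, zero_smul, zero_add] at hg
      intro i hi
      rcases Finset.mem_insert.1 hi with rfl | hi
      · exact hga
      · exact ih g hg i hi
    · exfalso
      set h : ι → K := fun i => (g a)⁻¹ * g i with hh
      have hha : h a = 1 := inv_mul_cancel₀ hga
      have hsum : ∑ i ∈ insert a s, h i • b i = 0 := by
        have := congrArg (fun v => (g a)⁻¹ • v) hg
        simpa [Finset.smul_sum, smul_smul, hh] using this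
      have hsum' : ∑ i ∈ insert a s, h i ^ Fintype.card k • b i = 0 := by
        have := congrArg F hsum
        simpa [map_sum, hF, hfix] using this
      have hdiff : ∑ i ∈ s, (h i ^ Fintype.card k - h i) • b i = 0 := by
        have h1 : ∑ i ∈ insert a s, (h i ^ Fintype.card k - h i) • b i = 0 := by
          simp_rw [sub_smul]
          rw [Finset.sum_sub_distrib, hsum, hsum', sub_self]
        rwa [Finset.sum_insert ha, hha, one_pow, sub_self, zero_smul, zero_add] at h1
      have hmem : ∀ i ∈ insert a s, ∃ c : k, algebraMap k K c = h i := by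
        intro i hi
        refine mem_range_algebraMap_of_pow_card_eq ?_
        rcases Finset.mem_insert.1 hi with rfl | hi
        · rw [hha, one_pow]
        · exact sub_eq_zero.1 (ih _ hdiff i hi)
      choose! c hc using hmem
      have hk : ∑ i ∈ insert a s, c i • b i = 0 := by
        rw [← hsum]
        refine Finset.sum_congr rfl fun i hi => ?_
        rw [← hc i hi, algebraMap_smul]
      have := linearIndependent_iff'.1 hb _ c hk a (Finset.mem_insert_self a s)
      have h1 := hc a (Finset.mem_insert_self a s)
      rw [this, map_zero, hha] at h1
      exact zero_ne_one h1

/-- On the span of the fixed vectors, `F - 1` is surjective. -/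
theorem exists_map_sub_add_eq_zero (k : Type u) [Field k] [Fintype k] [IsAlgClosed K]
    (hF : ∀ (c : K) v, F (c • v) = c ^ Fintype.card k • F v) {s : Set V} (hs : ∀ v ∈ s, F v = v)
    {w : V} (hw : w ∈ Submodule.span K s) :
    ∃ w' ∈ Submodule.span K s, F w' - w' + w = 0 := by
  induction hw using Submodule.closure_induction with
  | zero => exact ⟨0, zero_mem _, by simp⟩
  | add w₁ w₂ _ _ h₁ h₂ =>
    obtain ⟨w₁', hw₁, h₁⟩ := h₁
    obtain ⟨w₂', hw₂, h₂⟩ := h₂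
    refine ⟨w₁' + w₂', add_mem hw₁ hw₂, ?_⟩
    have h : F w₁' - w₁' + w₁ + (F w₂' - w₂' + w₂) = 0 := by rw [h₁, h₂, add_zero]
    rw [map_add, ← h]
    abel
  | smul_mem c v hv =>
    obtain ⟨t, ht⟩ := exists_pow_card_eq_sub k c
    refine ⟨t • v, Submodule.smul_mem _ _ (Submodule.subset_span hv), ?_⟩
    rw [hF, hs v hv, ← sub_smul, ← add_smul, ht, zero_smul]

end Semilinear

end Frobenius

end SkewLaurent

/-! ### Algebras that are split modulo a nilpotent ideal -/

/-- The algebra map `π` from `B` to a power of `k` has a nilpotent kernel: products of `N` elements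
of the kernel vanish for some `N`. -/
def NilpotentKer {k B : Type*} [Field k] [Ring B] [Algebra k B] {n : ℕ}
    (π : B →ₐ[k] (Fin n → k)) : Prop :=
  ∃ N : ℕ, ∀ l : List B, l.length = N → (∀ b ∈ l, π b = 0) → l.prod = 0

namespace NilpotentKer

variable {k B : Type*} [Field k] [Ring B] [Algebra k B] {n : ℕ} {π : B →ₐ[k] (Fin n → k)}

/-- A nonzero module has a nonzero multiplication by an element `p` that is annihilated by the
kernel of `π` on both sides: a longest product of elements of the kernel that does not annihilate
the module. -/
theorem exists_smul_ne_zero (hπ : NilpotentKer π) (M : Type*) [AddCommGroup M] [Module B M]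
    [Nontrivial M] :
    ∃ p : B, (∃ m : M, p • m ≠ 0) ∧
      ∀ j, π j = 0 → ∀ m : M, j • p • m = 0 ∧ p • j • m = 0 := by
  classical
  have hex : ∃ N : ℕ, ∀ l : List B, l.length = N → (∀ b ∈ l, π b = 0) →
      ∀ m : M, l.prod • m = 0 := by
    obtain ⟨N, hN⟩ := hπ
    exact ⟨N, fun l hl hl0 m => by rw [hN l hl hl0, zero_smul]⟩
  have hspec := Nat.find_spec hex
  obtain ⟨m₀, hm₀⟩ := exists_ne (0 : M)
  obtain ⟨N, hN⟩ : ∃ N, Nat.find hex = N + 1 := by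
    refine Nat.exists_eq_succ_of_ne_zero fun h => hm₀ ?_
    rw [h] at hspec
    simpa using hspec [] rfl (by simp) m₀
  rw [hN] at hspec
  have hmin := Nat.find_min hex (m := N) (by omega)
  push Not at hmin
  obtain ⟨l, hl, hl0, m, hm⟩ := hmin
  refine ⟨l.prod, ⟨m, hm⟩, fun j hj m' => ⟨?_, ?_⟩⟩
  · have := hspec (j :: l) (by simp [hl]) (by simpa [hj] using hl0) m'
    rwa [List.prod_cons, mul_smul] at this
  · have := hspec (l ++ [j]) (by simp [hl])
      (by
        intro b hb
        rcases List.mem_append.1 hb with hb | hb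
        · exact hl0 b hb
        · rw [List.mem_singleton.1 hb, hj]) m'
    rwa [List.prod_append, List.prod_singleton, mul_smul] at this

theorem mulOpposite (hπ : NilpotentKer π) :
    NilpotentKer ((AlgEquiv.toOpposite k (Fin n → k)).symm.toAlgHom.comp (AlgHom.op π)) := by
  obtain ⟨N, hN⟩ := hπ
  refine ⟨N, fun l hl hl0 => ?_⟩
  apply MulOpposite.unop_injective
  rw [MulOpposite.unop_list_prod]
  refine hN _ (by simpa using hl) fun b hb => ?_
  rw [List.mem_reverse, List.mem_map] at hb
  obtain ⟨c, hc, rfl⟩ := hb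
  exact hl0 c hc

end NilpotentKer

/-! ### Modules over `K[x, x⁻¹; φ] ⊗ B` -/

namespace SkewLaurent

variable {k K : Type u} [Field k] [Field K] [Algebra k K] {φ : K ≃ₐ[k] K}
  {B : Type u} [Ring B] [Algebra k B]

/-- The inclusion of `K[x, x⁻¹; φ]` in `K[x, x⁻¹; φ] ⊗ B`. -/
noncomputable def inL (φ : K ≃ₐ[k] K) (B : Type u) [Ring B] [Algebra k B] :
    SkewLaurent φ →+* SkewLaurent φ ⊗[k] B :=
  (Algebra.TensorProduct.includeLeft : SkewLaurent φ →ₐ[k] SkewLaurent φ ⊗[k] B).toRingHom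

/-- The inclusion of `B` in `K[x, x⁻¹; φ] ⊗ B`. -/
noncomputable def inR (φ : K ≃ₐ[k] K) (B : Type u) [Ring B] [Algebra k B] :
    B →+* SkewLaurent φ ⊗[k] B :=
  (Algebra.TensorProduct.includeRight : B →ₐ[k] SkewLaurent φ ⊗[k] B).toRingHom

/-- The inclusion of `K` in `K[x, x⁻¹; φ] ⊗ B`. -/
noncomputable def inK (φ : K ≃ₐ[k] K) (B : Type u) [Ring B] [Algebra k B] :
    K →+* SkewLaurent φ ⊗[k] B :=
  (inL φ B).comp (C φ)

/-- The unit `x ⊗ 1` of `K[x, x⁻¹; φ] ⊗ B`. -/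
noncomputable def xUnit (φ : K ≃ₐ[k] K) (B : Type u) [Ring B] [Algebra k B] :
    (SkewLaurent φ ⊗[k] B)ˣ :=
  Units.map (inL φ B : SkewLaurent φ →* SkewLaurent φ ⊗[k] B) (X φ)

/-- The element `x ⊗ 1` of `K[x, x⁻¹; φ] ⊗ B`. -/
noncomputable abbrev xElt (φ : K ≃ₐ[k] K) (B : Type u) [Ring B] [Algebra k B] :
    SkewLaurent φ ⊗[k] B := xUnit φ B

theorem inL_X : inL φ B (X φ) = xElt φ B := rfl

theorem inL_mul_inR (d : SkewLaurent φ) (b : B) : inL φ B d * inR φ B b = d ⊗ₜ b := by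
  change (d ⊗ₜ[k] (1 : B)) * ((1 : SkewLaurent φ) ⊗ₜ[k] b) = _
  simp

theorem inR_mul_inL (d : SkewLaurent φ) (b : B) : inR φ B b * inL φ B d = d ⊗ₜ b := by
  change ((1 : SkewLaurent φ) ⊗ₜ[k] b) * (d ⊗ₜ[k] (1 : B)) = _
  simp

theorem inR_mul_inL_comm (d : SkewLaurent φ) (b : B) :
    inR φ B b * inL φ B d = inL φ B d * inR φ B b := by
  rw [inR_mul_inL, inL_mul_inR]

theorem inR_mul_xElt (b : B) : inR φ B b * xElt φ B = xElt φ B * inR φ B b :=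
  inR_mul_inL_comm _ b

theorem xElt_mul_inK (a : K) : xElt φ B * inK φ B a = inK φ B (φ a) * xElt φ B := by
  rw [← inL_X]
  simp only [inK, RingHom.comp_apply, ← map_mul, X_mul_C]

theorem inK_algebraMap (c : k) :
    inK φ B (algebraMap k K c) = algebraMap k (SkewLaurent φ ⊗[k] B) c := rfl

theorem inR_algebraMap (c : k) :
    inR φ B (algebraMap k B c) = algebraMap k (SkewLaurent φ ⊗[k] B) c :=
  (Algebra.TensorProduct.includeRight : B →ₐ[k] SkewLaurent φ ⊗[k] B).commutes c

/-- The ring is generated by `K`, `x`, `x⁻¹` and `B`. -/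
theorem mem_of_generators (S : Subring (SkewLaurent φ ⊗[k] B)) (hK : ∀ a, inK φ B a ∈ S)
    (hX : xElt φ B ∈ S) (hX' : ((xUnit φ B)⁻¹ : (SkewLaurent φ ⊗[k] B)ˣ).val ∈ S)
    (hB : ∀ b, inR φ B b ∈ S) (t : SkewLaurent φ ⊗[k] B) : t ∈ S := by
  have hz : ∀ i : ℤ, ((xUnit φ B ^ i : (SkewLaurent φ ⊗[k] B)ˣ) : SkewLaurent φ ⊗[k] B) ∈ S := by
    intro i
    induction i with
    | zero => exact S.one_mem
    | succ i ih =>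
      rw [zpow_add_one, Units.val_mul]
      exact S.mul_mem ih hX
    | pred i ih =>
      rw [zpow_sub_one, Units.val_mul]
      exact S.mul_mem ih hX'
  induction t using TensorProduct.induction_on with
  | zero => exact S.zero_mem
  | add s t hs ht => exact S.add_mem hs ht
  | tmul d b =>
    rw [← inL_mul_inR]
    refine S.mul_mem ?_ (hB b)
    induction d using induction_on with
    | zero =>
      rw [map_zero]
      exact S.zero_mem
    | mono i a =>
      rw [monomial_eq, map_mul]
      refine S.mul_mem (hK a) ?_
      have := hz i
      rwa [xUnit, ← map_zpow] at this
    | add f g hf hg =>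
      rw [map_add]
      exact S.add_mem hf hg

section Modules

variable {M N : Type v} [AddCommGroup M] [Module (SkewLaurent φ ⊗[k] B) M]
  [AddCommGroup N] [Module (SkewLaurent φ ⊗[k] B) N]

/-- An additive map that commutes with `K`, `x` and `B` is linear. -/
theorem map_smul_of_generators (f : M →+ N) (hK : ∀ a m, f (inK φ B a • m) = inK φ B a • f m)
    (hX : ∀ m, f (xElt φ B • m) = xElt φ B • f m)
    (hB : ∀ b m, f (inR φ B b • m) = inR φ B b • f m) (t : SkewLaurent φ ⊗[k] B) (m : M) :
    f (t • m) = t • f m := by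
  let S : Subring (SkewLaurent φ ⊗[k] B) :=
    { carrier := {t | ∀ m, f (t • m) = t • f m}
      mul_mem' := fun {s t} hs ht m => by rw [mul_smul, hs, ht, mul_smul]
      one_mem' := fun m => by rw [one_smul, one_smul]
      add_mem' := fun {s t} hs ht m => by rw [add_smul, map_add, hs, ht, add_smul]
      zero_mem' := fun m => by rw [zero_smul, map_zero, zero_smul]
      neg_mem' := fun {s} hs m => by rw [neg_smul, map_neg, hs, neg_smul] }
  refine mem_of_generators S hK hX (fun m => ?_) hB t m
  have h := hX (((xUnit φ B)⁻¹ : (SkewLaurent φ ⊗[k] B)ˣ).val • m)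
  rw [smul_smul, Units.mul_inv, one_smul] at h
  rw [h, smul_smul, Units.inv_mul, one_smul]

variable (φ B M) in
/-- The group of fixed points of `x`. -/
noncomputable def fixedPoints : AddSubgroup M where
  carrier := {m | xElt φ B • m = m}
  add_mem' {a b} ha hb := by
    change xElt φ B • (a + b) = a + b
    rw [smul_add, ha, hb]
  zero_mem' := smul_zero _
  neg_mem' {a} ha := by
    change xElt φ B • (-a) = -a
    rw [smul_neg, ha]

theorem mem_fixedPoints {m : M} : m ∈ fixedPoints φ B M ↔ xElt φ B • m = m := Iff.rfl

theorem inR_smul_mem {m : M} (hm : m ∈ fixedPoints φ B M) (b : B) :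
    inR φ B b • m ∈ fixedPoints φ B M := by
  rw [mem_fixedPoints] at *
  rw [smul_smul, ← inR_mul_xElt, mul_smul, hm]

theorem map_mem_fixedPoints (f : M →ₗ[SkewLaurent φ ⊗[k] B] N) {m : M}
    (hm : m ∈ fixedPoints φ B M) : f m ∈ fixedPoints φ B N := by
  rw [mem_fixedPoints] at *
  rw [← map_smul, hm]

variable (φ B M) in
/-- The `K`-vector space structure on a module over `K[x, x⁻¹; φ] ⊗ B`. -/
@[reducible] noncomputable def moduleK : Module K M := Module.compHom M (inK φ B)

variable (φ B M) in
/-- The `k`-vector space structure on a module over `K[x, x⁻¹; φ] ⊗ B`. -/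
@[reducible] noncomputable def modulek : Module k M :=
  Module.compHom M (algebraMap k (SkewLaurent φ ⊗[k] B))

variable (φ B M) in
/-- The module is a finite-dimensional `K`-vector space spanned by fixed points of `x`. -/
def FixedSpanned : Prop :=
  letI := moduleK φ B M
  ∃ s : Set M, s.Finite ∧ s ⊆ fixedPoints φ B M ∧ Submodule.span K s = ⊤

theorem FixedSpanned.span_fixedPoints (h : FixedSpanned φ B M) :
    letI := moduleK φ B M
    Submodule.span K (fixedPoints φ B M : Set M) = ⊤ := by
  let _ := moduleK φ B M
  obtain ⟨s, -, hs, hspan⟩ := h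
  exact top_le_iff.1 (hspan ▸ Submodule.span_mono hs)

/-- An additive property that is stable under `K` and holds for the fixed points holds
everywhere. -/
theorem FixedSpanned.induction (h : FixedSpanned φ B M) {p : M → Prop} (h0 : p 0)
    (hadd : ∀ m n, p m → p n → p (m + n)) (hsmul : ∀ a m, p m → p (inK φ B a • m))
    (hfix : ∀ m ∈ fixedPoints φ B M, p m) (m : M) : p m := by
  let _ := moduleK φ B M
  have hm : m ∈ Submodule.span K (fixedPoints φ B M : Set M) := by
    rw [h.span_fixedPoints]
    trivial
  induction hm using Submodule.span_induction with
  | mem m hm => exact hfix m hm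
  | zero => exact h0
  | add m n _ _ hm hn => exact hadd m n hm hn
  | smul a m _ hm => exact hsmul a m hm

theorem FixedSpanned.ext (h : FixedSpanned φ B M) {f g : M →ₗ[SkewLaurent φ ⊗[k] B] N}
    (hfg : ∀ m ∈ fixedPoints φ B M, f m = g m) : f = g :=
  LinearMap.ext <| h.induction (by simp) (fun m n hm hn => by rw [map_add, map_add, hm, hn])
    (fun a m hm => by rw [map_smul, map_smul, hm]) hfg

theorem xElt_smul_inK_smul (a : K) (m : M) :
    xElt φ B • inK φ B a • m = inK φ B (φ a) • xElt φ B • m := by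
  rw [smul_smul, xElt_mul_inK, mul_smul]

theorem inR_smul_inK_smul (b : B) (a : K) (m : M) :
    inR φ B b • inK φ B a • m = inK φ B a • inR φ B b • m := by
  rw [smul_smul, smul_smul, inK, RingHom.comp_apply, inR_mul_inL_comm]

end Modules

/-! ### Modules of finite length are spanned by fixed points -/

section FiniteLength

variable {k K : Type u} [Field k] [Field K] [Algebra k K] {φ : K ≃ₐ[k] K}
  {B : Type u} [Ring B] [Algebra k B] {n : ℕ} {π : B →ₐ[k] (Fin n → k)}

section Simple

variable (φ) (M : Type v) [AddCommGroup M] [Module (SkewLaurent φ ⊗[k] B) M]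
  [IsSimpleModule (SkewLaurent φ ⊗[k] B) M]

theorem inR_smul_eq_zero_of_isSimpleModule (hπ : NilpotentKer π) {j : B} (hj : π j = 0) (m : M) :
    inR φ B j • m = 0 := by
  let _ : Module B M := Module.compHom M (inR φ B)
  have := IsSimpleModule.nontrivial (SkewLaurent φ ⊗[k] B) M
  let S : Submodule (SkewLaurent φ ⊗[k] B) M :=
    { carrier := {m | ∀ j : B, π j = 0 → inR φ B j • m = 0}
      add_mem' := fun {a b} ha hb j hj => by rw [smul_add, ha j hj, hb j hj, add_zero]
      zero_mem' := fun j _ => smul_zero _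
      smul_mem' := fun t m hm j hj => by
        induction t using TensorProduct.induction_on with
        | zero => rw [zero_smul, smul_zero]
        | add s t hs ht => rw [add_smul, smul_add, hs, ht, add_zero]
        | tmul d b =>
          rw [← inL_mul_inR, smul_smul, ← mul_assoc, inR_mul_inL_comm, mul_assoc, ← map_mul,
            mul_smul, hm (j * b) (by rw [map_mul, hj, zero_mul]), smul_zero] }
  obtain ⟨p, ⟨m₀, hm₀⟩, hp⟩ := hπ.exists_smul_ne_zero M
  have hS : S = ⊤ := by
    refine (eq_bot_or_eq_top S).resolve_left fun h => hm₀ ?_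
    rw [← Submodule.mem_bot (SkewLaurent φ ⊗[k] B), ← h]
    exact fun j hj => (hp j hj m₀).1
  have hm : m ∈ S := by
    rw [hS]
    trivial
  exact hm j hj

/-- `B` acts on a simple module by scalars of `k`: the endomorphisms `b - χᵢ(b)`, where the `χᵢ`
are the components of `π`, have product zero, so one of them is zero by Schur's lemma. -/
theorem exists_inR_smul_eq_of_isSimpleModule (hπ : NilpotentKer π) (b : B) :
    ∃ c : k, ∀ m : M, inR φ B b • m = algebraMap k (SkewLaurent φ ⊗[k] B) c • m := by
  have := IsSimpleModule.nontrivial (SkewLaurent φ ⊗[k] B) M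
  have hzero := fun {j : B} (hj : π j = 0) (m : M) =>
    inR_smul_eq_zero_of_isSimpleModule φ M hπ hj m
  let E : B → Module.End (SkewLaurent φ ⊗[k] B) M := fun b =>
    { toFun := fun m => inR φ B b • m
      map_add' := smul_add _
      map_smul' := fun t m => by
        induction t using TensorProduct.induction_on with
        | zero => simp
        | add s t hs ht =>
          rw [RingHom.id_apply] at *
          rw [add_smul, smul_add, hs, ht, add_smul]
        | tmul d b' =>
          have : inR φ B (b * b' - b' * b) • m = 0 := hzero (by
            rw [map_sub, map_mul, map_mul, mul_comm, sub_self]) m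
          rw [map_sub, sub_smul, sub_eq_zero, map_mul, map_mul] at this
          rw [RingHom.id_apply, ← inL_mul_inR, smul_smul, ← mul_assoc, inR_mul_inL_comm, mul_assoc,
            mul_smul, this, mul_smul, mul_smul] }
  by_contra! hne
  have hinj : ∀ i : Fin n, Function.Injective (E (b - algebraMap k B (π b i))) := fun i => by
    refine (LinearMap.injective_or_eq_zero _).resolve_right fun h => ?_
    obtain ⟨m, hm⟩ := hne (π b i)
    have := LinearMap.congr_fun h m
    change inR φ B _ • m = 0 at this
    rw [map_sub, inR_algebraMap, sub_smul, sub_eq_zero] at this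
    exact hm this
  have hprod : ∀ l : List B, (∀ c ∈ l, Function.Injective (E c)) → Function.Injective
      (E l.prod) := by
    intro l
    induction l with
    | nil =>
      intro _ m m' h
      change inR φ B 1 • m = inR φ B 1 • m' at h
      rwa [map_one, one_smul, one_smul] at h
    | cons c l ih =>
      intro hl m m' h
      change inR φ B _ • m = inR φ B _ • m' at h
      rw [List.prod_cons, map_mul, mul_smul, mul_smul] at h
      exact ih (fun c' hc' => hl c' (List.mem_cons_of_mem _ hc'))
        (hl c List.mem_cons_self h)
  set l := List.ofFn fun i : Fin n => b - algebraMap k B (π b i) with hl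
  have hl0 : π l.prod = 0 := by
    funext i
    rw [map_list_prod, Pi.list_prod_apply]
    refine List.prod_eq_zero ?_
    rw [List.map_map, List.mem_map]
    refine ⟨b - algebraMap k B (π b i), (List.mem_ofFn' _ _).2 ⟨i, rfl⟩, ?_⟩
    rw [Function.comp_apply, map_sub, AlgHom.commutes]
    simp
  obtain ⟨m, hm⟩ := exists_ne (0 : M)
  refine hm (hprod l ?_ (a₁ := m) (a₂ := 0) ?_)
  · intro c hc
    obtain ⟨i, rfl⟩ := (List.mem_ofFn' _ _).1 hc
    exact hinj i
  · change inR φ B _ • m = inR φ B _ • (0 : M)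
    rw [hzero hl0, smul_zero]

/-- A simple module over `K[x, x⁻¹; φ] ⊗ B` is a line over `K` spanned by a fixed point of `x`. -/
theorem exists_fixed_generator_of_isSimpleModule [Fintype k] [IsAlgClosed K]
    (hφ : ∀ a, φ a = a ^ Fintype.card k) (hπ : NilpotentKer π) :
    ∃ v ∈ fixedPoints φ B M, ∀ m : M, ∃ a : K, m = inK φ B a • v := by
  let _ : Module (SkewLaurent φ) M := Module.compHom M (inL φ B)
  have hsmul : ∀ (d : SkewLaurent φ) (m : M), d • m = inL φ B d • m := fun _ _ => rfl
  have := IsSimpleModule.nontrivial (SkewLaurent φ ⊗[k] B) M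
  have : IsSimpleModule (SkewLaurent φ) M :=
    { exists_pair_ne := exists_pair_ne _
      eq_bot_or_eq_top := fun W => by
        let W' : Submodule (SkewLaurent φ ⊗[k] B) M :=
          { W with
            smul_mem' := fun t m hm => by
              induction t using TensorProduct.induction_on with
              | zero =>
                rw [zero_smul]
                exact W.zero_mem
              | add s t hs ht =>
                rw [add_smul]
                exact W.add_mem hs ht
              | tmul d b =>
                obtain ⟨c, hc⟩ := exists_inR_smul_eq_of_isSimpleModule φ M hπ b
                rw [← inL_mul_inR, mul_smul, hc, ← inK_algebraMap, ← mul_smul]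
                have := W.smul_mem (d * C φ (algebraMap k K c)) hm
                rwa [hsmul, map_mul] at this }
        refine (eq_bot_or_eq_top W').imp (fun h => ?_) (fun h => ?_)
        · ext m
          exact (SetLike.ext_iff.1 h m : m ∈ W' ↔ _)
        · ext m
          exact (SetLike.ext_iff.1 h m : m ∈ W' ↔ _) }
  obtain ⟨e⟩ := nonempty_linearEquiv_of_isSimpleModule hφ M
  refine ⟨e.symm 1, ?_, fun m => ⟨e m, ?_⟩⟩
  · rw [mem_fixedPoints, ← inL_X, ← hsmul, ← map_smul, smul_def, act_X, map_one]
  · have := hsmul (C φ (e m)) (e.symm 1)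
    rw [inK, RingHom.comp_apply, ← this, ← map_smul, smul_def, act_C, mul_one,
      LinearEquiv.symm_apply_apply]

end Simple

/-- Every module of finite length over `K[x, x⁻¹; φ] ⊗ B` is spanned by finitely many fixed points
of `x`: extensions of modules spanned by fixed points are so again, since `x - 1` is surjective on
them. -/
theorem fixedSpanned_of_isFiniteLength [Fintype k] [IsAlgClosed K]
    (hφ : ∀ a, φ a = a ^ Fintype.card k) (hπ : NilpotentKer π) (M : Type v) [AddCommGroup M]
    [Module (SkewLaurent φ ⊗[k] B) M] (hM : IsFiniteLength (SkewLaurent φ ⊗[k] B) M) :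
    FixedSpanned φ B M := by
  induction hM with
  | of_subsingleton =>
    exact ⟨∅, Set.finite_empty, Set.empty_subset _, Subsingleton.elim _ _⟩
  | @of_simple_quotient M _ _ N _ _ ih =>
    let _ := moduleK φ B N
    let _ := moduleK φ B M
    obtain ⟨s, hsfin, hsfix, hspan⟩ := ih
    obtain ⟨v, hv, hv'⟩ := exists_fixed_generator_of_isSimpleModule φ (M ⧸ N) hφ hπ
    obtain ⟨w, rfl⟩ := Submodule.Quotient.mk_surjective N v
    let i : N →ₗ[K] M :=
      { toFun := fun m => m
        map_add' := fun _ _ => rfl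
        map_smul' := fun _ _ => rfl }
    have hN : ∀ m ∈ N, m ∈ Submodule.span K (i '' s) := by
      intro m hm
      rw [← Submodule.map_span, hspan]
      exact ⟨⟨m, hm⟩, trivial, rfl⟩
    have hfix : ∀ m ∈ i '' s, xElt φ B • m = m := by
      rintro _ ⟨m, hm, rfl⟩
      exact congrArg Subtype.val (hsfix hm)
    have hdiff : xElt φ B • w - w ∈ N := by
      rw [← Submodule.Quotient.eq]
      exact hv
    obtain ⟨w', hw', hw''⟩ := exists_map_sub_add_eq_zero k
      (F := DistribSMul.toAddMonoidHom M (xElt φ B))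
      (fun c m => by
        change xElt φ B • inK φ B c • m = inK φ B _ • xElt φ B • m
        rw [xElt_smul_inK_smul, hφ]) hfix (hN _ hdiff)
    refine ⟨insert (w + w') (i '' s), (hsfin.image i).insert _, ?_, ?_⟩
    · rw [Set.insert_subset_iff]
      refine ⟨?_, hfix⟩
      change xElt φ B • (w + w') = w + w'
      change xElt φ B • w' - w' + (xElt φ B • w - w) = 0 at hw''
      rw [← sub_eq_zero, ← hw'', smul_add]
      abel
    · rw [eq_top_iff]
      intro m _
      have hle := Submodule.span_mono (R := K) (Set.subset_insert (w + w') (i '' s))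
      obtain ⟨a, ha⟩ := hv' (Submodule.Quotient.mk m)
      rw [← Submodule.Quotient.mk_smul, Submodule.Quotient.eq] at ha
      have h1 : a • (w + w') ∈ Submodule.span K (insert (w + w') (i '' s)) :=
        Submodule.smul_mem _ _ (Submodule.subset_span (Set.mem_insert _ _))
      have h2 : a • w' ∈ Submodule.span K (insert (w + w') (i '' s)) :=
        Submodule.smul_mem _ _ (hle hw')
      have h3 : m = (m - inK φ B a • w) + (a • (w + w') - a • w') := by
        change m = (m - inK φ B a • w) + (inK φ B a • (w + w') - inK φ B a • w')
        rw [smul_add]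
        abel
      rw [h3]
      exact add_mem (hle (hN _ ha)) (sub_mem h1 h2)

end FiniteLength

/-! ### Maps between modules spanned by fixed points -/

section Extend

variable {k K : Type u} [Field k] [Field K] [Algebra k K] {φ : K ≃ₐ[k] K}
  {B : Type u} [Ring B] [Algebra k B]
  {M N : Type v} [AddCommGroup M] [Module (SkewLaurent φ ⊗[k] B) M]
  [AddCommGroup N] [Module (SkewLaurent φ ⊗[k] B) N]

noncomputable instance : Module B (fixedPoints φ B M) where
  smul b m := ⟨inR φ B b • (m : M), inR_smul_mem m.2 b⟩
  one_smul m := Subtype.ext (by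
    change inR φ B 1 • (m : M) = m
    rw [map_one, one_smul])
  mul_smul b c m := Subtype.ext (by
    change inR φ B (b * c) • (m : M) = inR φ B b • inR φ B c • (m : M)
    rw [map_mul, mul_smul])
  smul_zero b := Subtype.ext (smul_zero (inR φ B b))
  smul_add b m n := Subtype.ext (smul_add (inR φ B b) (m : M) n)
  add_smul b c m := Subtype.ext (by
    change inR φ B (b + c) • (m : M) = inR φ B b • (m : M) + inR φ B c • (m : M)
    rw [map_add, add_smul])
  zero_smul m := Subtype.ext (by
    change inR φ B 0 • (m : M) = 0
    rw [map_zero, zero_smul])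

theorem coe_smul_fixedPoints (b : B) (m : fixedPoints φ B M) :
    ((b • m : fixedPoints φ B M) : M) = inR φ B b • (m : M) := rfl

noncomputable instance : Module k (fixedPoints φ B M) :=
  Module.compHom _ (algebraMap k B)

theorem smul_fixedPoints_eq (c : k) (m : fixedPoints φ B M) : c • m = algebraMap k B c • m := rfl

instance : IsScalarTower k B (fixedPoints φ B M) where
  smul_assoc c b m := by rw [Algebra.smul_def, mul_smul, smul_fixedPoints_eq]

/-- The restriction of a linear map to the fixed points of `x`. -/
noncomputable def mapFixedPoints (f : M →ₗ[SkewLaurent φ ⊗[k] B] N) :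
    fixedPoints φ B M →ₗ[B] fixedPoints φ B N where
  toFun m := ⟨f m, map_mem_fixedPoints f m.2⟩
  map_add' m n := Subtype.ext (map_add f (m : M) n)
  map_smul' b m := Subtype.ext (map_smul f (inR φ B b) (m : M))

theorem FixedSpanned.mapFixedPoints_injective (h : FixedSpanned φ B M) :
    Function.Injective (mapFixedPoints (φ := φ) (B := B) (M := M) (N := N)) := fun _ _ hfg =>
  h.ext fun m hm => congrArg Subtype.val (LinearMap.congr_fun hfg ⟨m, hm⟩)

theorem isScalarTower_moduleK :
    letI := modulek φ B M
    letI := moduleK φ B M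
    IsScalarTower k K M := by
  let _ := modulek φ B M
  let _ := moduleK φ B M
  refine ⟨fun c a m => ?_⟩
  change inK φ B (c • a) • m = algebraMap k (SkewLaurent φ ⊗[k] B) c • inK φ B a • m
  rw [Algebra.smul_def, map_mul, inK_algebraMap, mul_smul]

variable (φ B M) in
/-- The inclusion of the fixed points of `x`. -/
noncomputable def fixedPointsSubtype :
    letI := modulek φ B M
    fixedPoints φ B M →ₗ[k] M :=
  letI := modulek φ B M
  { toFun := Subtype.val
    map_add' := fun _ _ => rfl
    map_smul' := fun c m => by
      change inR φ B (algebraMap k B c) • (m : M) = algebraMap k (SkewLaurent φ ⊗[k] B) c • (m : M)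
      rw [inR_algebraMap] }

variable [Fintype k]

theorem linearIndependent_coe_fixedPoints (hφ : ∀ a, φ a = a ^ Fintype.card k) {ι : Type*}
    {b : ι → fixedPoints φ B M} (hb : LinearIndependent k b) :
    letI := moduleK φ B M
    LinearIndependent K (fun i => (b i : M)) := by
  let _ := modulek φ B M
  let _ := moduleK φ B M
  have : IsScalarTower k K M := isScalarTower_moduleK (φ := φ) (B := B)
  refine linearIndependent_of_fixed (k := k) (F := DistribSMul.toAddMonoidHom M (xElt φ B))
    (fun c m => ?_) (hb.map' (fixedPointsSubtype φ B M)
      (LinearMap.ker_eq_bot.2 Subtype.val_injective)) fun i => (b i).2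
  change xElt φ B • inK φ B c • m = inK φ B _ • xElt φ B • m
  rw [xElt_smul_inK_smul, hφ]

theorem FixedSpanned.finite_fixedPoints (hφ : ∀ a, φ a = a ^ Fintype.card k)
    (h : FixedSpanned φ B M) : Module.Finite k (fixedPoints φ B M) := by
  let _ := moduleK φ B M
  have : Module.Finite K M := by
    obtain ⟨s, hs, -, hspan⟩ := h
    exact ⟨hs.toFinset, by simpa using hspan⟩
  let b := Module.Free.chooseBasis k (fixedPoints φ B M)
  have := (linearIndependent_coe_fixedPoints hφ b.linearIndependent).finite
  exact Module.Finite.of_basis b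

/-- A linear map of fixed points extends: a `k`-basis of the fixed points is a `K`-basis of the
module. -/
theorem FixedSpanned.exists_mapFixedPoints_eq (hφ : ∀ a, φ a = a ^ Fintype.card k)
    (h : FixedSpanned φ B M) (g : fixedPoints φ B M →ₗ[B] fixedPoints φ B N) :
    ∃ f : M →ₗ[SkewLaurent φ ⊗[k] B] N, mapFixedPoints f = g := by
  let _ := moduleK φ B M
  let _ := moduleK φ B N
  let _ := modulek φ B M
  let _ := modulek φ B N
  have : IsScalarTower k K M := isScalarTower_moduleK (φ := φ) (B := B)
  have : IsScalarTower k K N := isScalarTower_moduleK (φ := φ) (B := B)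
  let b := Module.Free.chooseBasis k (fixedPoints φ B M)
  have hspan : ⊤ ≤ Submodule.span K (Set.range fun i => (b i : M)) := by
    rw [← h.span_fixedPoints, Submodule.span_le]
    intro m hm
    have h1 : fixedPointsSubtype φ B M ⟨m, hm⟩ ∈ (⊤ : Submodule k (fixedPoints φ B M)).map
        (fixedPointsSubtype φ B M) := Submodule.mem_map_of_mem trivial
    rw [← b.span_eq, Submodule.map_span, ← Set.range_comp] at h1
    exact Submodule.span_le_restrictScalars k K _ h1
  let b' := Module.Basis.mk (linearIndependent_coe_fixedPoints hφ b.linearIndependent) hspan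
  let f := b'.constr K fun i => (g (b i) : N)
  have hf : ∀ m : fixedPoints φ B M, f m = g m := by
    have h1 : (f.restrictScalars k).comp (fixedPointsSubtype φ B M) =
        (fixedPointsSubtype φ B N).comp (g.restrictScalars k) := by
      refine b.ext fun i => ?_
      have h2 : b' i = (b i : M) := Module.Basis.mk_apply _ _ i
      change f (b i) = g (b i)
      rw [← h2]
      exact b'.constr_basis K _ i
    exact fun m => LinearMap.congr_fun h1 m
  have hfK : ∀ a m, f (inK φ B a • m) = inK φ B a • f m := fun a m => map_smul f a m
  have hfX : ∀ m, f (xElt φ B • m) = xElt φ B • f m := by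
    refine h.induction (by rw [smul_zero, map_zero, smul_zero])
      (fun m n hm hn => by rw [smul_add, map_add, hm, hn, map_add, smul_add])
      (fun a m hm => by rw [xElt_smul_inK_smul, hfK, hm, hfK, xElt_smul_inK_smul])
      (fun m hm => ?_)
    have h1 := hf ⟨m, hm⟩
    simp only at h1
    rw [mem_fixedPoints.1 hm, h1, mem_fixedPoints.1 (g ⟨m, hm⟩).2]
  have hfB : ∀ c m, f (inR φ B c • m) = inR φ B c • f m := by
    intro c
    refine h.induction (by rw [smul_zero, map_zero, smul_zero])
      (fun m n hm hn => by rw [smul_add, map_add, hm, hn, map_add, smul_add])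
      (fun a m hm => by rw [inR_smul_inK_smul, hfK, hm, hfK, inR_smul_inK_smul])
      (fun m hm => ?_)
    have h1 := hf (c • ⟨m, hm⟩)
    rw [map_smul, coe_smul_fixedPoints, coe_smul_fixedPoints, ← hf] at h1
    exact h1
  let F : M →ₗ[SkewLaurent φ ⊗[k] B] N :=
    { toFun := f
      map_add' := map_add f
      map_smul' := map_smul_of_generators f.toAddMonoidHom hfK hfX hfB }
  exact ⟨F, LinearMap.ext fun m => Subtype.ext (hf m)⟩

end Extend

section Induced

variable {k K : Type u} [Field k] [Field K] [Algebra k K]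
  {B : Type u} [Ring B] [Algebra k B]

/-- The module `K ⊗ V` over `K[x, x⁻¹; φ] ⊗ B`, for a `B`-module `V`. -/
def Induced (_φ : K ≃ₐ[k] K) (B : Type u) [Ring B] [Algebra k B] (V : Type v) [AddCommGroup V]
    [Module k V] [Module B V] [IsScalarTower k B V] : Type (max u v) := K ⊗[k] V

variable (φ : K ≃ₐ[k] K) (V : Type v) [AddCommGroup V] [Module k V] [Module B V]
  [IsScalarTower k B V]

noncomputable instance : AddCommGroup (Induced φ B V) :=
  inferInstanceAs (AddCommGroup (K ⊗[k] V))

/-- The action of `K[x, x⁻¹; φ] ⊗ B` on `K ⊗ V`. -/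
noncomputable def inducedAct (B : Type u) [Ring B] [Algebra k B] (V : Type v) [AddCommGroup V]
    [Module k V] [Module B V] [IsScalarTower k B V] :
    SkewLaurent φ ⊗[k] B →ₐ[k] Module.End k (K ⊗[k] V) :=
  Algebra.TensorProduct.lift ((Module.End.rTensorAlgHom k K V).comp (act φ))
    ((Module.End.lTensorAlgHom k V K).comp (Algebra.lsmul k k V : B →ₐ[k] Module.End k V))
    (fun _ _ => show Commute _ _ from TensorProduct.ext' fun _ _ => rfl)

noncomputable instance : Module (SkewLaurent φ ⊗[k] B) (Induced φ B V) :=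
  Module.compHom (K ⊗[k] V) (inducedAct φ B V).toRingHom

variable {V}

/-- The pure tensor `c ⊗ v`. -/
noncomputable def Induced.tmul (B : Type u) [Ring B] [Algebra k B] {V : Type v} [AddCommGroup V]
    [Module k V] [Module B V] [IsScalarTower k B V] (c : K) (v : V) : Induced φ B V := c ⊗ₜ[k] v

theorem tmul_smul_induced (d : SkewLaurent φ) (b : B) (c : K) (v : V) :
    (d ⊗ₜ[k] b) • Induced.tmul φ B c v = Induced.tmul φ B (act φ d c) (b • v) := by
  change inducedAct φ B V (d ⊗ₜ[k] b) (c ⊗ₜ[k] v) = _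
  have h := Algebra.TensorProduct.lift_tmul ((Module.End.rTensorAlgHom k K V).comp (act φ))
    ((Module.End.lTensorAlgHom k V K).comp (Algebra.lsmul k k V : B →ₐ[k] Module.End k V))
    (fun _ _ => show Commute _ _ from TensorProduct.ext' fun _ _ => rfl) d b
  exact LinearMap.congr_fun h (c ⊗ₜ[k] v)

theorem inK_smul_induced (a c : K) (v : V) :
    inK φ B a • Induced.tmul φ B c v = Induced.tmul φ B (a * c) v := by
  refine (tmul_smul_induced φ (C φ a) (1 : B) c v).trans ?_
  rw [one_smul, act_C]

theorem xElt_smul_induced (c : K) (v : V) :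
    xElt φ B • Induced.tmul φ B c v = Induced.tmul φ B (φ c) v := by
  refine (tmul_smul_induced φ (X φ) (1 : B) c v).trans ?_
  rw [one_smul, act_X]

theorem inR_smul_induced (b : B) (c : K) (v : V) :
    inR φ B b • Induced.tmul φ B c v = Induced.tmul φ B c (b • v) := by
  refine (tmul_smul_induced φ 1 b c v).trans ?_
  rw [map_one, Module.End.one_apply]

theorem induced_induction {p : Induced φ B V → Prop} (h0 : p 0)
    (ht : ∀ c v, p (Induced.tmul φ B c v)) (ha : ∀ m n, p m → p n → p (m + n))
    (m : Induced φ B V) : p m :=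
  TensorProduct.induction_on (motive := p) m h0 ht ha

theorem inK_smul_induced_eq (a : K) (m : Induced φ B V) :
    inK φ B a • m = HSMul.hSMul (β := K ⊗[k] V) a m := by
  induction m using induced_induction with
  | h0 => exact (smul_zero _).trans (smul_zero (A := K ⊗[k] V) a).symm
  | ht c v => exact inK_smul_induced φ a c v
  | ha m n hm hn =>
    rw [smul_add, hm, hn]
    exact (smul_add (A := K ⊗[k] V) a m n).symm

/-- The map `v ↦ 1 ⊗ v` to the fixed points of `x`. -/
noncomputable def toFixedPoints (B : Type u) [Ring B] [Algebra k B] (V : Type v) [AddCommGroup V]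
    [Module k V] [Module B V] [IsScalarTower k B V] :
    V →ₗ[B] fixedPoints φ B (Induced φ B V) where
  toFun v := ⟨Induced.tmul φ B 1 v, by rw [mem_fixedPoints, xElt_smul_induced, map_one]⟩
  map_add' v w := Subtype.ext (TensorProduct.tmul_add (1 : K) v w)
  map_smul' b v := Subtype.ext (inR_smul_induced φ b 1 v).symm

theorem toFixedPoints_injective :
    Function.Injective (toFixedPoints φ B V) := fun v w h => by
  have h1 : (1 : K) ⊗ₜ[k] v = (1 : K) ⊗ₜ[k] w := congrArg Subtype.val h
  exact Module.FaithfullyFlat.tensorProduct_mk_injective (A := k) (B := K) V h1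

/-- Coordinates in a `k`-basis of `V`, as maps from `K ⊗ V` to `K`, commute with `x`. -/
theorem basis_repr_xElt_smul {ι : Type*} (b : Module.Basis ι k V) (i : ι)
    (m : Induced φ B V) :
    (Algebra.TensorProduct.basis K b).repr (xElt φ B • m : Induced φ B V) i =
      φ ((Algebra.TensorProduct.basis K b).repr m i) := by
  induction m using induced_induction with
  | h0 =>
    rw [smul_zero]
    have : (Algebra.TensorProduct.basis K b).repr (0 : Induced φ B V) = 0 :=
      map_zero (Algebra.TensorProduct.basis K b).repr
    rw [this, Finsupp.zero_apply, map_zero]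
  | ht c v =>
    rw [xElt_smul_induced]
    simp only [Induced.tmul, Algebra.TensorProduct.basis_repr_tmul, Finsupp.smul_apply,
      smul_eq_mul, map_mul, Finsupp.mapRange_apply, AlgEquiv.commutes]
  | ha m n hm hn =>
    have hadd : ∀ m n : Induced φ B V, (Algebra.TensorProduct.basis K b).repr (m + n) =
      (Algebra.TensorProduct.basis K b).repr m + (Algebra.TensorProduct.basis K b).repr n :=
      fun m n => map_add (Algebra.TensorProduct.basis K b).repr m n
    rw [smul_add, hadd, hadd, Finsupp.add_apply, Finsupp.add_apply, hm, hn, map_add]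

variable {φ}

theorem toFixedPoints_surjective [Fintype k] (hφ : ∀ a, φ a = a ^ Fintype.card k) :
    Function.Surjective (toFixedPoints φ B V) := by
  rintro ⟨m, hm⟩
  let b := Module.Free.chooseBasis k V
  let b' := Algebra.TensorProduct.basis K b
  have h1 : ∀ i, ∃ c : k, algebraMap k K c = b'.repr m i := fun i => by
    refine mem_range_algebraMap_of_pow_card_eq ?_
    have := basis_repr_xElt_smul φ b i m
    rw [mem_fixedPoints.1 hm, hφ] at this
    exact this.symm
  choose c hc using h1
  have hm' : (m : K ⊗[k] V) = 1 ⊗ₜ[k] ∑ i ∈ (b'.repr m).support, c i • b i := by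
    rw [TensorProduct.tmul_sum]
    conv_lhs => rw [← b'.linearCombination_repr m]
    rw [Finsupp.linearCombination_apply, Finsupp.sum]
    refine Finset.sum_congr rfl fun i _ => ?_
    rw [← hc i, Algebra.TensorProduct.basis_apply, algebraMap_smul, TensorProduct.tmul_smul]
  exact ⟨_, Subtype.ext hm'.symm⟩

theorem isFiniteLength_of_finite_moduleK {M : Type v} [AddCommGroup M]
    [Module (SkewLaurent φ ⊗[k] B) M] (h : letI := moduleK φ B M; Module.Finite K M) :
    IsFiniteLength (SkewLaurent φ ⊗[k] B) M := by
  let _ := moduleK φ B M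
  let _ : SMul K (SkewLaurent φ ⊗[k] B) := ⟨fun a t => inK φ B a * t⟩
  have : IsScalarTower K (SkewLaurent φ ⊗[k] B) M := ⟨fun a t m => mul_smul (inK φ B a) t m⟩
  rw [isFiniteLength_iff_isNoetherian_isArtinian]
  exact ⟨isNoetherian_of_tower K inferInstance, isArtinian_of_tower K inferInstance⟩

theorem isFiniteLength_induced [Module.Finite k V] :
    IsFiniteLength (SkewLaurent φ ⊗[k] B) (Induced φ B V) := by
  refine isFiniteLength_of_finite_moduleK ?_
  let _ := moduleK φ B (Induced φ B V)
  let e : (K ⊗[k] V) ≃ₗ[K] Induced φ B V :=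
    { AddEquiv.refl _ with
      map_smul' := fun a m => (inK_smul_induced_eq φ a m).symm }
  exact Module.Finite.equiv e

end Induced

/-! ### The equivalence of the categories of modules of finite length -/

/-- The class of left `S`-modules of finite length. -/
def _root_.ModuleCat.finiteLength (S : Type u) [Ring S] : ObjectProperty (ModuleCat.{u} S) :=
  fun M => IsFiniteLength S M

theorem _root_.IsFiniteLength.finite_of_algebra {k B : Type*} [Field k] [Ring B] [Algebra k B]
    [Module.Finite k B] {V : Type*} [AddCommGroup V] [Module k V] [Module B V]
    [IsScalarTower k B V] (h : IsFiniteLength B V) : Module.Finite k V := by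
  rw [isFiniteLength_iff_isNoetherian_isArtinian] at h
  have := h.1
  exact Module.Finite.trans B V

theorem _root_.IsFiniteLength.of_finite_algebra {k B : Type*} [Field k] [Ring B] [Algebra k B]
    {V : Type*} [AddCommGroup V] [Module k V] [Module B V]
    [IsScalarTower k B V] [Module.Finite k V] : IsFiniteLength B V := by
  rw [isFiniteLength_iff_isNoetherian_isArtinian]
  exact ⟨isNoetherian_of_tower k inferInstance, isArtinian_of_tower k inferInstance⟩

section Functor

variable {k K : Type u} [Field k] [Fintype k] [Field K] [Algebra k K] [IsAlgClosed K]
  {φ : K ≃ₐ[k] K} (hφ : ∀ a, φ a = a ^ Fintype.card k)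
  {B : Type u} [Ring B] [Algebra k B] {n : ℕ} {π : B →ₐ[k] (Fin n → k)} (hπ : NilpotentKer π)

/-- The functor of fixed points of `x`, on modules of finite length. -/
noncomputable def fixedPointsFunctor :
    (ModuleCat.finiteLength (SkewLaurent φ ⊗[k] B)).FullSubcategory ⥤ (ModuleCat.finiteLength B).FullSubcategory :=
  (ModuleCat.finiteLength B).lift
    { obj := fun M => ModuleCat.of B (fixedPoints φ B M.obj)
      map := fun f => ModuleCat.ofHom (mapFixedPoints f.hom.hom)
      map_id := fun _ => rfl
      map_comp := fun _ _ => rfl }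
    fun M => by
      have := (fixedSpanned_of_isFiniteLength hφ hπ M.obj M.property).finite_fixedPoints hφ
      exact IsFiniteLength.of_finite_algebra (k := k)

theorem fixedPointsFunctor_isEquivalence [Module.Finite k B] :
    (fixedPointsFunctor hφ hπ).IsEquivalence where
  faithful :=
    { map_injective := fun {M N} f g h => by
        have hM := fixedSpanned_of_isFiniteLength hφ hπ M.obj M.property
        ext : 2
        exact hM.mapFixedPoints_injective
          (congrArg (fun f : (fixedPointsFunctor hφ hπ).obj M ⟶ _ => f.hom.hom) h) }
  full :=
    { map_surjective := fun {M N} g => by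
        have hM := fixedSpanned_of_isFiniteLength hφ hπ M.obj M.property
        obtain ⟨f, hf⟩ := hM.exists_mapFixedPoints_eq hφ g.hom.hom
        refine ⟨⟨ModuleCat.ofHom f⟩, ?_⟩
        ext : 2
        exact hf }
  essSurj :=
    { mem_essImage := fun V => by
        let _ : Module k V.obj := Module.compHom V.obj (algebraMap k B)
        have : IsScalarTower k B V.obj :=
          ⟨fun c b v => by
            rw [Algebra.smul_def, mul_smul]
            rfl⟩
        have := V.property.finite_of_algebra (k := k)
        refine ⟨⟨ModuleCat.of _ (Induced φ B V.obj), isFiniteLength_induced⟩, ⟨?_⟩⟩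
        exact ((ModuleCat.finiteLength B).ι.preimageIso (LinearEquiv.toModuleIso
          (LinearEquiv.ofBijective (toFixedPoints φ B V.obj)
            ⟨toFixedPoints_injective φ, toFixedPoints_surjective hφ⟩))).symm }

end Functor

end SkewLaurent

/-! ### Derivations between characters and extensions of simple modules -/

theorem exists_section_of_subsingleton_ext {C : Type*} [Category* C] [Abelian C]
    [HasExt.{v} C] {S : ShortComplex C} (hS : S.ShortExact)
    (h : Subsingleton (Abelian.Ext.{v} S.X₃ S.X₁ 1)) : ∃ s : S.X₃ ⟶ S.X₂, s ≫ S.g = 𝟙 S.X₃ := by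
  obtain ⟨s, hs⟩ := Abelian.Ext.covariant_sequence_exact₃ S.X₃ hS
    (Abelian.Ext.mk₀ (𝟙 S.X₃)) (zero_add 1) (Subsingleton.elim _ _)
  obtain ⟨s, rfl⟩ := Abelian.Ext.homEquiv₀.symm.surjective s
  refine ⟨s, Abelian.Ext.homEquiv₀.symm.injective ?_⟩
  change Abelian.Ext.mk₀ (s ≫ S.g) = Abelian.Ext.mk₀ (𝟙 S.X₃)
  rw [← Abelian.Ext.mk₀_comp_mk₀]
  exact hs

section Derivation

variable {k A : Type u} [Field k] [Ring A] [Algebra k A]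

/-- The action of `A` on `k` from the right through a character. -/
noncomputable def characterHom (χ : A →ₐ[k] k) : Aᵐᵒᵖ →+* k :=
  (χ : A →+* k).fromOpposite fun _ _ => Commute.all _ _

/-- The one-dimensional right module given by a character. -/
noncomputable def characterModule (χ : A →ₐ[k] k) : RightMod A :=
  (ModuleCat.restrictScalars (characterHom χ)).obj (ModuleCat.of k k)

/-- The element `c` of the one-dimensional module. -/
def characterModule.mk (χ : A →ₐ[k] k) (c : k) : characterModule χ := c

theorem characterModule.smul_mk (χ : A →ₐ[k] k) (a : Aᵐᵒᵖ) (c : k) :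
    a • characterModule.mk χ c = characterModule.mk χ (χ a.unop * c) := rfl

theorem characterModule.isSimpleModule (χ : A →ₐ[k] k) :
    IsSimpleModule Aᵐᵒᵖ (characterModule χ) := by
  have : Nontrivial (characterModule χ) := inferInstanceAs (Nontrivial k)
  have key : ∀ d c : k, d ≠ 0 → MulOpposite.op (algebraMap k A (c / d)) • characterModule.mk χ d =
      characterModule.mk χ c := fun d c hd => by
    rw [characterModule.smul_mk, MulOpposite.unop_op, AlgHom.commutes]
    exact congrArg (characterModule.mk χ) (div_mul_cancel₀ c hd)
  rw [isSimpleModule_iff_toSpanSingleton_surjective]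
  exact ⟨inferInstance, fun m hm c => ⟨_, key m c hm⟩⟩

/-- The simple right module given by a character. -/
noncomputable def simpleOfCharacter (χ : A →ₐ[k] k) : SimpleRightMod A :=
  ⟨characterModule χ, characterModule.isSimpleModule χ⟩

theorem mk_simpleOfCharacter_ne {χ χ' : A →ₐ[k] k} (h : χ ≠ χ') :
    GabrielPoint.mk (simpleOfCharacter χ) ≠ GabrielPoint.mk (simpleOfCharacter χ') := by
  intro heq
  obtain ⟨e⟩ : Nonempty (characterModule χ ≃ₗ[Aᵐᵒᵖ] characterModule χ') := Quotient.exact heq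
  set w : k := e (characterModule.mk χ 1) with hw
  have hw0 : w ≠ 0 := by
    intro h0
    have h1 : e (characterModule.mk χ 1) = 0 := h0
    rw [LinearEquiv.map_eq_zero_iff] at h1
    exact one_ne_zero (α := k) h1
  have key : ∀ a : A, ∀ c : k, χ a = c → χ' a * w = c * w := by
    intro a c hc
    have h1 := map_smul e (MulOpposite.op a) (characterModule.mk χ 1)
    have h2 := map_smul e (MulOpposite.op (algebraMap k A c)) (characterModule.mk χ 1)
    rw [characterModule.smul_mk] at h1 h2
    rw [MulOpposite.unop_op, hc] at h1
    rw [MulOpposite.unop_op, AlgHom.commutes] at h2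
    have h3 := h1.symm.trans h2
    change χ' a * w = χ' (algebraMap k A c) * w at h3
    rwa [AlgHom.commutes] at h3
  exact h (AlgHom.ext fun a => (mul_right_cancel₀ hw0 (key a _ rfl)).symm)

variable {χ χ' : A →ₐ[k] k} {δ : A →ₗ[k] k}

/-- The representation of `A` on row vectors of length two by the upper triangular matrices with
diagonal `(χ, χ')` and upper right entry `δ`. -/
noncomputable def triangularHom (hδ : ∀ a b, δ (a * b) = χ a * δ b + δ a * χ' b) :
    Aᵐᵒᵖ →+* Module.End k (k × k) where
  toFun a :=
    { toFun := fun p => (p.1 * χ a.unop, p.1 * δ a.unop + p.2 * χ' a.unop)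
      map_add' := fun p q => by
        ext <;> simp only [Prod.fst_add, Prod.snd_add] <;> ring
      map_smul' := fun c p => by
        ext <;> simp only [Prod.smul_fst, Prod.smul_snd, smul_eq_mul, RingHom.id_apply] <;> ring }
  map_one' := by
    have h1 : δ 1 = 0 := by simpa using hδ 1 1
    refine LinearMap.ext fun p => ?_
    change (p.1 * χ 1, p.1 * δ 1 + p.2 * χ' 1) = p
    simp [h1]
  map_zero' := by
    refine LinearMap.ext fun p => ?_
    change (p.1 * χ 0, p.1 * δ 0 + p.2 * χ' 0) = 0
    simp
  map_add' a b := by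
    refine LinearMap.ext fun p => ?_
    change (p.1 * χ (a.unop + b.unop), p.1 * δ (a.unop + b.unop) + p.2 * χ' (a.unop + b.unop)) =
      (p.1 * χ a.unop, p.1 * δ a.unop + p.2 * χ' a.unop) +
      (p.1 * χ b.unop, p.1 * δ b.unop + p.2 * χ' b.unop)
    simp only [map_add]
    ext <;> simp only [Prod.fst_add, Prod.snd_add] <;> ring
  map_mul' a b := by
    refine LinearMap.ext fun p => ?_
    change (p.1 * χ (b.unop * a.unop), p.1 * δ (b.unop * a.unop) + p.2 * χ' (b.unop * a.unop)) =
      (p.1 * χ b.unop * χ a.unop,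
        p.1 * χ b.unop * δ a.unop + (p.1 * δ b.unop + p.2 * χ' b.unop) * χ' a.unop)
    simp only [map_mul, hδ]
    ext <;> ring

/-- The extension of one-dimensional right modules given by a derivation between characters. -/
noncomputable def triangularModule (hδ : ∀ a b, δ (a * b) = χ a * δ b + δ a * χ' b) :
    RightMod A :=
  (ModuleCat.restrictScalars (triangularHom hδ)).obj (ModuleCat.of (Module.End k (k × k)) (k × k))

/-- The row vector `p`. -/
def triangularModule.mk (hδ : ∀ a b, δ (a * b) = χ a * δ b + δ a * χ' b) (p : k × k) :
    triangularModule hδ := p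

theorem triangularModule.smul_mk (hδ : ∀ a b, δ (a * b) = χ a * δ b + δ a * χ' b) (a : Aᵐᵒᵖ)
    (p : k × k) : a • triangularModule.mk hδ p =
      triangularModule.mk hδ (p.1 * χ a.unop, p.1 * δ a.unop + p.2 * χ' a.unop) := rfl

/-- The inclusion of the second coordinate. -/
noncomputable def triangularInr (hδ : ∀ a b, δ (a * b) = χ a * δ b + δ a * χ' b) :
    characterModule χ' →ₗ[Aᵐᵒᵖ] triangularModule hδ where
  toFun c := triangularModule.mk hδ (0, c)
  map_add' c d := Prod.ext (add_zero (0 : k)).symm rfl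
  map_smul' a c := by
    have key : ∀ c : k, ((0, χ' a.unop * c) : k × k) =
        (0 * χ a.unop, 0 * δ a.unop + c * χ' a.unop) := fun c => by
      ext <;> simp only <;> ring
    exact key c

/-- The projection to the first coordinate. -/
noncomputable def triangularFst (hδ : ∀ a b, δ (a * b) = χ a * δ b + δ a * χ' b) :
    triangularModule hδ →ₗ[Aᵐᵒᵖ] characterModule χ where
  toFun p := characterModule.mk χ (Prod.fst (α := k) (β := k) p)
  map_add' _ _ := rfl
  map_smul' a p := mul_comm (Prod.fst (α := k) (β := k) p) (χ a.unop)

/-- The extension of the module of `χ` by that of `χ'` given by a derivation. -/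
noncomputable def triangularComplex (hδ : ∀ a b, δ (a * b) = χ a * δ b + δ a * χ' b) :
    ShortComplex (RightMod A) where
  X₁ := characterModule χ'
  X₂ := triangularModule hδ
  X₃ := characterModule χ
  f := ModuleCat.ofHom (X := characterModule χ') (Y := triangularModule hδ) (triangularInr hδ)
  g := ModuleCat.ofHom (X := triangularModule hδ) (Y := characterModule χ) (triangularFst hδ)
  zero := rfl

theorem triangularComplex_shortExact (hδ : ∀ a b, δ (a * b) = χ a * δ b + δ a * χ' b) :
    (triangularComplex hδ).ShortExact :=
  { exact := by
      rw [ShortComplex.moduleCat_exact_iff]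
      exact fun p hp => ⟨Prod.snd (α := k) (β := k) p, Prod.ext (Eq.symm hp) rfl⟩
    mono_f := (ModuleCat.mono_iff_injective _).2 fun _ _ h => congrArg (Prod.snd (α := k)) h
    epi_g := (ModuleCat.epi_iff_surjective _).2 fun (c : k) => ⟨((c, 0) : k × k), rfl⟩ }

/-- The extension given by a derivation `δ` between different characters splits, so `δ` is a multiple
of `χ - χ'` and vanishes where they agree. -/
theorem derivation_eq_zero (hQ : (gabrielQuiver A).TotallyDisconnected) (hχ : χ ≠ χ')
    (hδ : ∀ a b, δ (a * b) = χ a * δ b + δ a * χ' b) {a : A} (ha : χ a = χ' a) : δ a = 0 := by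
  have hsub : Subsingleton (Abelian.Ext.{u} (characterModule χ) (characterModule χ') 1) := by
    rw [← not_nontrivial_iff_subsingleton]
    intro hn
    exact hQ _ _ (mk_simpleOfCharacter_ne hχ)
      ⟨simpleOfCharacter χ, simpleOfCharacter χ', rfl, rfl, hn⟩
  obtain ⟨s, hs⟩ := exists_section_of_subsingleton_ext (triangularComplex_shortExact hδ) hsub
  set w : k × k := s.hom (characterModule.mk χ 1) with hw
  have hw1 : w.1 = 1 := congrArg (fun f => f.hom (characterModule.mk χ 1)) hs
  have h1 := map_smul s.hom (MulOpposite.op a) (characterModule.mk χ 1)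
  have h2 := map_smul s.hom (MulOpposite.op (algebraMap k A (χ a))) (characterModule.mk χ 1)
  have h3 : MulOpposite.op a • characterModule.mk χ 1 =
      MulOpposite.op (algebraMap k A (χ a)) • characterModule.mk χ 1 := by
    rw [characterModule.smul_mk, characterModule.smul_mk, MulOpposite.unop_op,
      MulOpposite.unop_op, AlgHom.commutes]
    rfl
  rw [h3] at h1
  have h4 : w.1 * δ (algebraMap k A (χ a)) + w.2 * χ' (algebraMap k A (χ a)) =
    w.1 * δ a + w.2 * χ' a := congrArg (Prod.snd (α := k)) (h2.symm.trans h1)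
  have h5 : δ 1 = 0 := by simpa using hδ 1 1
  rw [AlgHom.commutes, Algebra.algebraMap_eq_smul_one (χ a), map_smul, h5, smul_zero, mul_zero,
    zero_add, hw1, one_mul, ← ha] at h4
  change w.2 * χ a = δ a + w.2 * χ a at h4
  exact right_eq_add.1 h4

end Derivation

/-! ### Elementary algebras with totally disconnected quiver are products of local algebras -/

section Structure

variable {k A : Type u} [Field k] [Ring A] [Algebra k A]

theorem IsElementary.exists_nilpotentKer (hA : IsElementary k A) :
    ∃ (n : ℕ) (π : A →ₐ[k] (Fin n → k)), Function.Surjective π ∧ NilpotentKer π := by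
  obtain ⟨hfin, n, ⟨e⟩⟩ := hA
  have : IsArtinianRing A := IsArtinianRing.of_finite k A
  refine ⟨n, e.toAlgHom.comp (Ideal.Quotient.mkₐ k (Ring.jacobson A)),
    e.surjective.comp (Ideal.Quotient.mkₐ_surjective k _), ?_⟩
  obtain ⟨N, hN⟩ := IsSemiprimaryRing.isNilpotent (R := A)
  refine ⟨N, fun l hl hl0 => ?_⟩
  have key : ∀ l : List A, (∀ a ∈ l, a ∈ Ring.jacobson A) → l.prod ∈ Ring.jacobson A ^ l.length := by
    intro l
    induction l with
    | nil =>
      intro _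
      rw [List.length_nil, Submodule.pow_zero, Ideal.one_eq_top]
      trivial
    | cons a l ih =>
      intro h
      rw [List.prod_cons, List.length_cons, Ideal.IsTwoSided.pow_succ]
      exact Ideal.mul_mem_mul (h a List.mem_cons_self)
        (ih fun b hb => h b (List.mem_cons_of_mem _ hb))
  have := key l fun a ha => by
    have h := hl0 a ha
    rw [AlgHom.comp_apply] at h
    exact Ideal.Quotient.eq_zero_iff_mem.1 (e.injective (h.trans (map_zero e).symm))
  rw [hl, hN] at this
  exact this

variable {n : ℕ} {π : A →ₐ[k] (Fin n → k)}

/-- The kernel of `π`, as a `k`-subspace. -/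
def kerSubspace (π : A →ₐ[k] (Fin n → k)) : Submodule k A := LinearMap.ker π.toLinearMap

theorem mem_kerSubspace {a : A} : a ∈ kerSubspace π ↔ π a = 0 := Iff.rfl

theorem mul_mem_kerSubspace_pow {N : ℕ} (hN : N ≠ 0) {a : A} (ha : a ∈ kerSubspace π ^ N) (b : A) :
    a * b ∈ kerSubspace π ^ N := by
  obtain ⟨N, rfl⟩ := Nat.exists_eq_succ_of_ne_zero hN
  rw [Nat.succ_eq_add_one, pow_succ] at *
  refine Submodule.mul_induction_on ha (fun x hx y hy => ?_) (fun x y hx hy => ?_)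
  · rw [mul_assoc]
    refine Submodule.mul_mem_mul hx ?_
    rw [mem_kerSubspace] at *
    rw [map_mul, hy, zero_mul]
  · rw [add_mul]
    exact add_mem hx hy

theorem NilpotentKer.eq_zero (hπ : NilpotentKer π) {a : A} (ha : ∀ N, a ∈ kerSubspace π ^ (N + 1)) :
    a = 0 := by
  obtain ⟨N, hN⟩ := hπ
  have key : ∀ N, ∀ a ∈ kerSubspace π ^ N,
      a ∈ Submodule.span k {b | ∃ l : List A, l.length = N ∧ (∀ c ∈ l, π c = 0) ∧ l.prod = b} := by
    intro N a ha
    induction ha using Submodule.pow_induction_on_left' with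
    | algebraMap r =>
      rw [Algebra.algebraMap_eq_smul_one]
      exact Submodule.smul_mem _ _ (Submodule.subset_span ⟨[], rfl, by simp, rfl⟩)
    | add x y i _ _ hx hy => exact add_mem hx hy
    | mem_mul m hm i x hmem hx =>
      clear hmem
      induction hx using Submodule.span_induction with
      | mem x hx =>
        obtain ⟨l, hl, hl0, rfl⟩ := hx
        refine Submodule.subset_span ⟨m :: l, by simp [hl], ?_, by simp⟩
        intro c hc
        rcases List.mem_cons.1 hc with rfl | hc
        · exact hm
        · exact hl0 c hc
      | zero =>
        rw [mul_zero]
        exact zero_mem _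
      | add x y _ _ hx hy =>
        rw [mul_add]
        exact add_mem hx hy
      | smul c x _ hx =>
        rw [mul_smul_comm]
        exact Submodule.smul_mem _ _ hx
  have h := key (N + 1) a (ha N)
  rw [← Submodule.mem_bot k]
  refine Submodule.span_le.2 ?_ h
  rintro _ ⟨l, hl, hl0, rfl⟩
  match l with
  | [] => simp at hl
  | c :: l =>
    rw [List.prod_cons, hN l (by simpa using hl) fun b hb => hl0 b (List.mem_cons_of_mem _ hb),
      mul_zero]
    exact zero_mem _

/-- The components of `π`. -/
noncomputable def component (π : A →ₐ[k] (Fin n → k)) (i : Fin n) : A →ₐ[k] k :=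
  (Pi.evalAlgHom k (fun _ : Fin n => k) i).comp π

theorem component_apply (i : Fin n) (a : A) : component π i a = π a i := rfl

variable {e : Fin n → A}

/-- Off-diagonal parts lie in the square of the radical: otherwise a linear form on `A` that
vanishes on the square would give a derivation between different characters that is not inner. -/
theorem mul_mul_mem_kerSubspace_sq (hQ : (gabrielQuiver A).TotallyDisconnected)
    (he : CompleteOrthogonalIdempotents e) (hπe : ∀ i, π (e i) = Pi.single i 1) {i j : Fin n}
    (hij : i ≠ j) (a : A) : e i * a * e j ∈ kerSubspace π ^ 2 := by
  by_contra hmem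
  obtain ⟨l, hl, hle⟩ := Submodule.exists_le_ker_of_notMem hmem
  let δ : A →ₗ[k] k := l.comp ((LinearMap.mulRight k (e j)).comp (LinearMap.mulLeft k (e i)))
  have hδ_apply : ∀ b, δ b = l (e i * b * e j) := fun _ => rfl
  have hei : ∀ m, component π m (e i) = Pi.single (M := fun _ : Fin n => k) i 1 m := fun m => by
    rw [component_apply, hπe]
  have horth : e i * e j = 0 := he.ortho hij
  have hχ : component π i ≠ component π j := by
    intro h
    have h1 := hei i
    rw [h, hei j, Pi.single_eq_same, Pi.single_eq_of_ne hij.symm] at h1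
    exact zero_ne_one h1
  have hδ : ∀ b c, δ (b * c) = component π i b * δ c + δ b * component π j c := by
    intro b c
    set b' := b - algebraMap k A (component π i b) with hb'
    set c' := c - algebraMap k A (component π j c) with hc'
    have hsq : (e i * b') * (c' * e j) ∈ kerSubspace π ^ 2 := by
      rw [pow_two]
      refine Submodule.mul_mem_mul ?_ ?_
      · rw [mem_kerSubspace]
        funext m
        rw [map_mul, hπe, hb', map_sub, AlgHom.commutes]
        by_cases hm : m = i
        · subst hm
          simp [component_apply]
        · simp [hm]
      · rw [mem_kerSubspace]
        funext m
        rw [map_mul, hπe, hc', map_sub, AlgHom.commutes]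
        by_cases hm : m = j
        · subst hm
          simp [component_apply]
        · simp [hm]
    have hdecomp : e i * (b * c) * e j = (e i * b') * (c' * e j) +
        component π i b • (e i * c * e j) + component π j c • (e i * b * e j) := by
      have h1 : e i * (b * c) * e j - (e i * b') * (c' * e j) -
          component π i b • (e i * c * e j) - component π j c • (e i * b * e j) =
          -((component π i b * component π j c) • (e i * e j)) := by
        simp only [hb', hc', Algebra.algebraMap_eq_smul_one, mul_sub, sub_mul, mul_smul_comm,
          smul_mul_assoc, mul_one, one_mul, mul_assoc, smul_sub, smul_smul, mul_comm]
        abel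
      rw [horth, smul_zero, neg_zero, sub_sub, sub_sub, sub_eq_zero] at h1
      rw [h1, add_assoc]
    rw [hδ_apply, hdecomp, map_add, map_add, map_smul, map_smul, hδ_apply, hδ_apply,
      LinearMap.mem_ker.1 (hle hsq), zero_add, smul_eq_mul, smul_eq_mul, mul_comm (l _)]
  refine hl ?_
  have hz : ∀ m, component π m (e i * a * e j) = 0 := fun m => by
    rw [map_mul, map_mul, mul_right_comm, ← map_mul, horth, map_zero, zero_mul]
  have h := derivation_eq_zero hQ hχ hδ ((hz i).trans (hz j).symm)
  rwa [hδ_apply, mul_assoc, mul_assoc, (he.idem j).eq, ← mul_assoc, ← mul_assoc, (he.idem i).eq]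
    at h

theorem mul_mul_mem_kerSubspace_pow (hQ : (gabrielQuiver A).TotallyDisconnected)
    (he : CompleteOrthogonalIdempotents e) (hπe : ∀ i, π (e i) = Pi.single i 1) {i j : Fin n}
    (hij : i ≠ j) {N : ℕ} {a : A} (ha : a ∈ kerSubspace π ^ (N + 1)) :
    e i * a * e j ∈ kerSubspace π ^ (N + 2) := by
  induction N generalizing a with
  | zero => exact mul_mul_mem_kerSubspace_sq hQ he hπe hij a
  | succ N ih =>
    rw [pow_succ'] at ha
    refine Submodule.mul_induction_on ha (fun x hx y hy => ?_) (fun x y hx hy => ?_)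
    · have hsum : e i * (x * y) * e j = ∑ m, (e i * x * e m) * (y * e j) := by
        rw [← Finset.sum_mul, ← Finset.mul_sum, he.complete, mul_one]
        simp only [mul_assoc]
      rw [hsum]
      refine Submodule.sum_mem _ fun m _ => ?_
      by_cases hm : i = m
      · subst hm
        have h1 : (e i * x * e i) * (y * e j) = (e i * x) * (e i * y * e j) := by
          simp only [mul_assoc]
        rw [h1, pow_succ' _ (N + 1 + 1)]
        refine Submodule.mul_mem_mul ?_ (ih hy)
        rw [mem_kerSubspace] at *
        rw [map_mul, hx, mul_zero]
      · have h2 : N + 1 + 2 = 2 + (N + 1) := by omega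
        rw [h2, pow_add]
        exact Submodule.mul_mem_mul (mul_mul_mem_kerSubspace_sq hQ he hπe hm x)
          (mul_mem_kerSubspace_pow N.succ_ne_zero hy _)
    · rw [mul_add, add_mul]
      exact add_mem hx hy

/-- If the quiver is totally disconnected, then the primitive idempotents of an elementary algebra
are central. -/
theorem exists_central_idempotents (hQ : (gabrielQuiver A).TotallyDisconnected)
    (hsurj : Function.Surjective π) (hπ : NilpotentKer π) :
    ∃ e : Fin n → A, CompleteOrthogonalIdempotents e ∧ (∀ i, π (e i) = Pi.single i 1) ∧
      ∀ i a, e i * a = a * e i := by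
  obtain ⟨e, he, hπe⟩ := CompleteOrthogonalIdempotents.lift_of_isNilpotent_ker (π : A →+* (Fin n → k))
    (fun x hx => by
      obtain ⟨N, hN⟩ := hπ
      refine ⟨N, ?_⟩
      have := hN (List.replicate N x) (by simp) (fun b hb => by
        rw [List.eq_of_mem_replicate hb]
        exact hx)
      rwa [List.prod_replicate] at this)
    (CompleteOrthogonalIdempotents.single fun _ : Fin n => k) (fun i => hsurj _)
  have hπe' : ∀ i, π (e i) = Pi.single i 1 := fun i => congrFun hπe i
  refine ⟨e, he, hπe', ?_⟩
  have hzero : ∀ i j, i ≠ j → ∀ a, e i * a * e j = 0 := by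
    intro i j hij a
    refine hπ.eq_zero fun N => ?_
    induction N with
    | zero =>
      rw [zero_add, pow_one, mem_kerSubspace, map_mul, map_mul, mul_right_comm, ← map_mul,
        he.ortho hij, map_zero, zero_mul]
    | succ N ih =>
      have := mul_mul_mem_kerSubspace_pow hQ he hπe' hij ih
      rwa [mul_assoc, mul_assoc, (he.idem j).eq, ← mul_assoc, ← mul_assoc, (he.idem i).eq] at this
  intro i a
  have h1 : e i * a = e i * a * e i := by
    conv_lhs => rw [← mul_one (e i * a), ← he.complete, Finset.mul_sum]
    exact Finset.sum_eq_single i (fun j _ hj => hzero i j hj.symm a)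
      (fun h => absurd (Finset.mem_univ i) h)
  have h2 : a * e i = e i * a * e i := by
    conv_lhs => rw [← one_mul (a * e i), ← he.complete, Finset.sum_mul]
    rw [mul_assoc]
    exact Finset.sum_eq_single i (fun j _ hj => by rw [← mul_assoc]; exact hzero j i hj a)
      (fun h => absurd (Finset.mem_univ i) h)
  rw [h1, h2]

end Structure

/-! ### The converse of Schur's lemma over an elementary algebra -/

/-- Suppose that `B` is a product of local algebras with residue field `k`. If `End M` is a division
ring, then one of the factors acts on `M`, and for an element `p` of `B` that acts nontrivially and
is annihilated by the radical, and a linear form `l`, the endomorphism `m ↦ l (p m) s` with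
`s = p m₀` is invertible. So `M` is a line. -/
theorem NilpotentKer.isSimpleModule_of_isDivRing {k B : Type*} [Field k] [Ring B] [Algebra k B]
    {n : ℕ} {π : B →ₐ[k] (Fin n → k)} (hπ : NilpotentKer π) {e : Fin n → B}
    (hidem : ∀ i, e i * e i = e i) (hsum : ∑ i, e i = 1) (hπe : ∀ i, π (e i) = Pi.single i 1)
    (hcomm : ∀ i b, e i * b = b * e i) (M : Type*) [AddCommGroup M] [Module B M]
    (hM : IsDivRing (Module.End B M)) : IsSimpleModule B M := by
  obtain ⟨hnt, hunit⟩ := hM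
  have hMnt : Nontrivial M := by
    by_contra h
    rw [not_nontrivial_iff_subsingleton] at h
    exact one_ne_zero (α := Module.End B M) (LinearMap.ext fun m => Subsingleton.elim _ _)
  let _ : Module k M := Module.compHom M (algebraMap k B)
  have : IsScalarTower k B M := ⟨fun c b m => by
    rw [Algebra.smul_def, mul_smul]
    rfl⟩
  let E : Fin n → Module.End B M := fun i =>
    { toFun := fun m => e i • m
      map_add' := smul_add _
      map_smul' := fun b m => by rw [smul_smul, hcomm, mul_smul, RingHom.id_apply] }
  obtain ⟨i, hi⟩ : ∃ i, ∀ m : M, e i • m = m := by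
    have h1 : ∑ i, E i = 1 := LinearMap.ext fun m => by
      rw [LinearMap.sum_apply]
      change ∑ i, e i • m = m
      rw [← Finset.sum_smul, hsum, one_smul]
    obtain ⟨i, -, hi⟩ := Finset.exists_ne_zero_of_sum_ne_zero
      (h1.symm ▸ one_ne_zero : ∑ i, E i ≠ 0)
    have hEi : E i * E i = E i := LinearMap.ext fun m => by
      change e i • e i • m = e i • m
      rw [smul_smul, hidem]
    have h2 : E i = 1 := (hunit _ hi).mul_left_cancel (hEi.trans (mul_one _).symm)
    exact ⟨i, fun m => LinearMap.congr_fun h2 m⟩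
  -- modulo the radical, `B` acts by the scalars `π b i`
  have hact : ∀ b : B, ∃ j, π j = 0 ∧ ∀ m : M, b • m = π b i • m + j • m := by
    intro b
    refine ⟨b * e i - π b i • e i, ?_, fun m => ?_⟩
    · rw [map_sub, map_smul, map_mul, hπe]
      funext m
      by_cases hm : m = i
      · subst hm
        simp
      · simp [hm]
    · rw [sub_smul, mul_smul, smul_assoc, hi, add_sub_cancel]
  obtain ⟨p, ⟨m₀, hm₀⟩, hp⟩ := hπ.exists_smul_ne_zero M
  set s := p • m₀ with hs
  obtain ⟨l, hl, -⟩ := Submodule.exists_le_ker_of_notMem (K := k) (p := (⊥ : Submodule k M))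
    (v := s) (by simpa using hm₀)
  have hcomm' : ∀ (b : B) (c : k) (m : M), b • c • m = c • b • m := fun b c m => by
    rw [← algebraMap_smul B c m, ← algebraMap_smul B c (b • m), smul_smul, smul_smul,
      Algebra.commutes]
  let f : Module.End B M :=
    { toFun := fun m => l (p • m) • s
      map_add' := fun m m' => by rw [smul_add, map_add, add_smul]
      map_smul' := fun b m => by
        obtain ⟨j, hj, hb⟩ := hact b
        have hbs : b • s = π b i • s := by rw [hb, hs, (hp j hj m₀).1, add_zero]
        rw [RingHom.id_apply, hcomm', hbs, hb, smul_add, (hp j hj m).2, add_zero, hcomm', map_smul,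
          smul_smul, smul_eq_mul, mul_comm] }
  have hf0 : f ≠ 0 := fun h => by
    have : l s • s = 0 := LinearMap.congr_fun h m₀
    exact (smul_ne_zero hl hm₀) this
  have hspan : ∀ m : M, ∃ c : k, m = c • s := fun m => by
    obtain ⟨m', rfl⟩ := ((Module.End.isUnit_iff f).1 (hunit f hf0)).2 m
    exact ⟨_, rfl⟩
  rw [isSimpleModule_iff_toSpanSingleton_surjective]
  refine ⟨hMnt, fun m hm m' => ?_⟩
  obtain ⟨c, rfl⟩ := hspan m
  obtain ⟨c', rfl⟩ := hspan m'
  have hc : c ≠ 0 := fun h => hm (by rw [h, zero_smul])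
  refine ⟨algebraMap k B (c' / c), ?_⟩
  rw [LinearMap.toSpanSingleton_apply, algebraMap_smul, smul_smul, div_mul_cancel₀ _ hc]

theorem modHasCSL_of_isElementary {k A : Type u} [Field k] [Ring A] [Algebra k A]
    (hA : IsElementary k A) (hQ : (gabrielQuiver A).TotallyDisconnected) : ModHasCSL A := by
  obtain ⟨n, π, hsurj, hπ⟩ := hA.exists_nilpotentKer
  obtain ⟨e, he, hπe, hcomm⟩ := exists_central_idempotents hQ hsurj hπ
  intro M _ hM
  refine hπ.mulOpposite.isSimpleModule_of_isDivRing (e := fun i => .op (e i)) (fun i => ?_) ?_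
    (fun i => hπe i) (fun i b => ?_) M hM
  · rw [← MulOpposite.op_mul, (he.idem i).eq]
  · rw [← Finset.op_sum, he.complete, MulOpposite.op_one]
  · exact MulOpposite.unop_injective (hcomm i b.unop).symm

/-! ### Transport along ring isomorphisms -/

theorem IsDivRing.of_ringEquiv {E E' : Type*} [Ring E] [Ring E'] (f : E ≃+* E')
    (h : IsDivRing E) : IsDivRing E' := by
  obtain ⟨h1, h2⟩ := h
  refine ⟨f.symm.toEquiv.nontrivial, fun x hx => ?_⟩
  have := (h2 (f.symm x) fun h0 => hx (by rw [← f.apply_symm_apply x, h0, map_zero])).map f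
  rwa [RingEquiv.apply_symm_apply] at this

section Transport

variable {S S' : Type*} [Ring S] [Ring S'] (e : S ≃+* S') {N : Type*} [AddCommGroup N]
  [Module S N] [Module S' N] (h : ∀ (s : S) (n : N), e s • n = s • n)

include h in
theorem RingEquiv.symm_smul_eq (s : S') (n : N) : e.symm s • n = s • n := by
  rw [← h, e.apply_symm_apply]

/-- Isomorphic rings acting compatibly have the same submodules. -/
def RingEquiv.submoduleOrderIso : Submodule S N ≃o Submodule S' N where
  toFun W := { W with smul_mem' := fun s m hm => by
                        rw [← e.symm_smul_eq h]
                        exact W.smul_mem _ hm }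
  invFun W := { W with smul_mem' := fun s m hm => by
                        rw [← h]
                        exact W.smul_mem _ hm }
  left_inv _ := rfl
  right_inv _ := rfl
  map_rel_iff' := Iff.rfl

/-- Isomorphic rings acting compatibly have the same endomorphisms. -/
def RingEquiv.moduleEnd : Module.End S N ≃+* Module.End S' N where
  toFun f := { f with map_smul' := fun s m => by
                        rw [← e.symm_smul_eq h]
                        exact (map_smul f _ _).trans (e.symm_smul_eq h _ _) }
  invFun f := { f with map_smul' := fun s m => by
                        rw [← h]
                        exact (map_smul f _ _).trans (h _ _) }
  left_inv _ := rfl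
  right_inv _ := rfl
  map_mul' _ _ := rfl
  map_add' _ _ := rfl

include h in
theorem RingEquiv.isSimpleModule (hN : IsSimpleModule S N) : IsSimpleModule S' N := by
  rw [isSimpleModule_iff] at *
  exact (e.submoduleOrderIso h).symm.isSimpleOrder

include h in
theorem RingEquiv.isFiniteLength (hN : IsFiniteLength S N) : IsFiniteLength S' N := by
  rw [isFiniteLength_iff_isNoetherian_isArtinian] at *
  obtain ⟨h1, h2⟩ := hN
  rw [isNoetherian_iff'] at *
  exact ⟨(e.submoduleOrderIso h).symm.toOrderEmbedding.wellFoundedGT,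
    (e.submoduleOrderIso h).symm.toOrderEmbedding.wellFoundedLT⟩

end Transport

instance (S : Type u) [Ring S] : (ModuleCat.finiteLength S).IsClosedUnderIsomorphisms where
  of_iso e h := LinearEquiv.isFiniteLength e.toLinearEquiv h

/-- Isomorphic rings have equivalent categories of modules of finite length. -/
noncomputable def RingEquiv.finiteLengthEquivalence {S S' : Type u} [Ring S] [Ring S']
    (e : S ≃+* S') : (ModuleCat.finiteLength S').FullSubcategory ≌
      (ModuleCat.finiteLength S).FullSubcategory :=
  (ModuleCat.restrictScalarsEquivalenceOfRingEquiv e).congrFullSubcategory (by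
    ext M
    let _ : Module S M := Module.compHom M e.toRingHom
    exact ⟨fun h => e.isFiniteLength (N := M) (fun _ _ => rfl) h,
      fun h => e.symm.isFiniteLength (N := M)
        (fun s m => by
          change e (e.symm s) • m = s • m
          rw [e.apply_symm_apply]) h⟩)

namespace SkewLaurent

/-! ### The converse of Schur's lemma for modules of finite length -/

section CSL

variable {k K : Type u} [Field k] [Fintype k] [Field K] [Algebra k K] [IsAlgClosed K]
  {φ : K ≃ₐ[k] K} {B : Type u} [Ring B] [Algebra k B] {n : ℕ} {π : B →ₐ[k] (Fin n → k)}
  {M : Type v} [AddCommGroup M] [Module (SkewLaurent φ ⊗[k] B) M]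

/-- Endomorphisms of a module of finite length are endomorphisms of its fixed points. -/
noncomputable def endEquiv (hφ : ∀ a, φ a = a ^ Fintype.card k) (hM : FixedSpanned φ B M) :
    Module.End (SkewLaurent φ ⊗[k] B) M ≃+* Module.End B (fixedPoints φ B M) :=
  RingEquiv.ofBijective
    ({ toFun := mapFixedPoints
       map_one' := rfl
       map_mul' := fun _ _ => rfl
       map_zero' := rfl
       map_add' := fun _ _ => rfl } :
      Module.End (SkewLaurent φ ⊗[k] B) M →+* Module.End B (fixedPoints φ B M))
    ⟨hM.mapFixedPoints_injective, hM.exists_mapFixedPoints_eq hφ⟩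

theorem isSimpleModule_of_fixedPoints (hφ : ∀ a, φ a = a ^ Fintype.card k) (hπ : NilpotentKer π)
    (hM : IsFiniteLength (SkewLaurent φ ⊗[k] B) M)
    (hsimple : IsSimpleModule B (fixedPoints φ B M)) :
    IsSimpleModule (SkewLaurent φ ⊗[k] B) M := by
  have := IsSimpleModule.nontrivial B (fixedPoints φ B M)
  have hMnt : Nontrivial M := (Subtype.val_injective (p := (· ∈ fixedPoints φ B M))).nontrivial
  refine { exists_pair_ne := exists_pair_ne _, eq_bot_or_eq_top := fun W => ?_ }
  have hW := fixedSpanned_of_isFiniteLength hφ hπ W (hM.of_injective W.subtype_injective)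
  have hMs := fixedSpanned_of_isFiniteLength hφ hπ M hM
  let U : Submodule B (fixedPoints φ B M) :=
    { carrier := {m | (m : M) ∈ W}
      add_mem' := fun ha hb => W.add_mem ha hb
      zero_mem' := W.zero_mem
      smul_mem' := fun b m hm => W.smul_mem (inR φ B b) hm }
  have hfix : ∀ m ∈ fixedPoints φ B W, (m : M) ∈ fixedPoints φ B M := fun m hm =>
    congrArg Subtype.val hm
  rcases eq_bot_or_eq_top U with hU | hU
  · left
    rw [eq_bot_iff]
    intro m hm
    have : ∀ m : W, m = 0 := hW.induction rfl (fun m n hm hn => by rw [hm, hn, add_zero])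
      (fun a m hm => by rw [hm, smul_zero])
      (fun m hm => by
        have h1 : (⟨m, hfix m hm⟩ : fixedPoints φ B M) ∈ U := m.2
        rw [hU, Submodule.mem_bot] at h1
        exact Subtype.ext (Subtype.ext_iff.1 h1 : (m : M) = 0))
    exact congrArg Subtype.val (this ⟨m, hm⟩)
  · right
    rw [eq_top_iff]
    intro m _
    refine hMs.induction (p := fun m => m ∈ W) W.zero_mem (fun m n => W.add_mem)
      (fun a m => W.smul_mem _) (fun m hm => ?_) m
    have h1 : (⟨m, hm⟩ : fixedPoints φ B M) ∈ U := by
      rw [hU]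
      trivial
    exact h1

end CSL

/-! ### The ring `K[x, x⁻¹; φ] ⊗ A` -/

section Ring

variable {k K : Type u} [Field k] [Field K] [Algebra k K] {φ : K ≃ₐ[k] K}

theorem isNoetherianRing_tensor (φ : K ≃ₐ[k] K) (B : Type u) [Ring B] [Algebra k B]
    [Module.Finite k B] : IsNoetherianRing (SkewLaurent φ ⊗[k] B) := by
  have h1 : Module.Finite (SkewLaurent φ) (SkewLaurent φ ⊗[k] B) := Module.Finite.base_change _ _ _
  have h2 : IsNoetherian (SkewLaurent φ) (SkewLaurent φ ⊗[k] B) := inferInstance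
  exact isNoetherian_of_tower (SkewLaurent φ) h2

/-- Right modules over `K[x, x⁻¹; φ] ⊗ A` are left modules over `K[x, x⁻¹; φ] ⊗ Aᵒᵖ`. -/
noncomputable def tensorOpEquiv (φ : K ≃ₐ[k] K) (A : Type u) [Ring A] [Algebra k A] :
    (SkewLaurent φ ⊗[k] A)ᵐᵒᵖ ≃+* SkewLaurent φ ⊗[k] Aᵐᵒᵖ :=
  ((Algebra.TensorProduct.opAlgEquiv k k (SkewLaurent φ) A).symm.trans
    (Algebra.TensorProduct.congr (opEquiv φ).symm AlgEquiv.refl)).toRingEquiv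

end Ring

end SkewLaurent

/-! ### A division ring of fractions as a module -/

/-- If `g` maps `R` onto a ring `D` that is embedded in a division ring `Q` of left fractions, but
has a nonzero element `d` without left inverse, then the right `R`-module `Q` violates the converse
of Schur's lemma: its endomorphism ring is `Q`, and `D` is a proper submodule. -/
theorem not_modHasCSL_of_fractions {R D Q : Type u} [Ring R] [Ring D] [DivisionRing Q]
    (g : R →+* D) (hg : Function.Surjective g) (i : D →+* Q) (hi : Function.Injective i)
    (hfrac : ∀ q : Q, ∃ s r : D, i s ≠ 0 ∧ q = (i s)⁻¹ * i r) {d : D} (hd0 : d ≠ 0)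
    (hd : ∀ d', d' * d ≠ 1) : ¬ ModHasCSL R := by
  intro hCSL
  let _ : Module Rᵐᵒᵖ Q := Module.compHom Q (i.comp g).op
  have hsmul : ∀ (r : R) (q : Q), MulOpposite.op r • q = q * i (g r) := fun _ _ => rfl
  have hend : ∀ (f : Module.End Rᵐᵒᵖ Q) (q : Q), f q = f 1 * q := by
    intro f q
    have hmul : ∀ (p : Q) (d : D), f (p * i d) = f p * i d := by
      intro p d
      obtain ⟨r, rfl⟩ := hg d
      exact map_smul f (MulOpposite.op r) p
    obtain ⟨s, r, hs, rfl⟩ := hfrac q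
    have h1 := hmul (i s)⁻¹ s
    rw [inv_mul_cancel₀ hs] at h1
    rw [hmul, h1, mul_assoc, mul_inv_cancel_left₀ hs]
  have hdiv : IsDivRing (Module.End Rᵐᵒᵖ Q) := by
    refine ⟨inferInstance, fun f hf => ?_⟩
    have hf1 : f 1 ≠ 0 := fun h => hf (LinearMap.ext fun q => by
      rw [hend, h, zero_mul, LinearMap.zero_apply])
    rw [Module.End.isUnit_iff]
    refine ⟨fun q q' h => ?_, fun q => ⟨(f 1)⁻¹ * q, ?_⟩⟩
    · rw [hend f q, hend f q'] at h
      exact mul_left_cancel₀ hf1 h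
    · rw [hend, mul_inv_cancel_left₀ hf1]
  have hsimple : IsSimpleModule Rᵐᵒᵖ Q := hCSL (ModuleCat.of Rᵐᵒᵖ Q) trivial hdiv
  let W : Submodule Rᵐᵒᵖ Q :=
    { carrier := Set.range i
      add_mem' := by
        rintro _ _ ⟨a, rfl⟩ ⟨b, rfl⟩
        exact ⟨a + b, map_add i a b⟩
      zero_mem' := ⟨0, map_zero i⟩
      smul_mem' := by
        rintro r _ ⟨a, rfl⟩
        exact ⟨a * g r.unop, map_mul i a _⟩ }
  rcases eq_bot_or_eq_top W with h | h
  · have h1 : (1 : Q) ∈ W := ⟨1, map_one i⟩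
    rw [h, Submodule.mem_bot] at h1
    exact one_ne_zero h1
  · have h1 : (i d)⁻¹ ∈ W := by
      rw [h]
      trivial
    obtain ⟨d', hd'⟩ := h1
    refine hd d' (hi ?_)
    rw [map_mul, hd', map_one, inv_mul_cancel₀]
    rw [Ne, map_eq_zero_iff i hi]
    exact hd0

open nonZeroDivisors in
theorem SkewLaurent.not_modHasCSL {k K : Type u} [Field k] [Field K] [Algebra k K]
    (φ : K ≃ₐ[k] K) {A : Type u} [Ring A] [Algebra k A] (χ : A →ₐ[k] k) :
    ¬ ModHasCSL (SkewLaurent φ ⊗[k] A) := by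
  obtain ⟨_⟩ := nonempty_oreSet_of_strongRankCondition (R := SkewLaurent φ)
  let g : SkewLaurent φ ⊗[k] A →ₐ[k] SkewLaurent φ :=
    Algebra.TensorProduct.lift (AlgHom.id k _) ((Algebra.ofId k (SkewLaurent φ)).comp χ)
      fun d a => show Commute _ _ from (Algebra.commutes (χ a) d).symm
  have hinj : Function.Injective (OreLocalization.numeratorRingHom :
      SkewLaurent φ →+* OreLocalization (SkewLaurent φ)⁰ (SkewLaurent φ)) :=
    OreLocalization.numeratorHom_inj inf_le_left
  refine not_modHasCSL_of_fractions (Q := OreLocalization (SkewLaurent φ)⁰ (SkewLaurent φ)) (d := (X φ : SkewLaurent φ) - 1) g.toRingHom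
    (fun d => ⟨d ⊗ₜ 1, ?_⟩) OreLocalization.numeratorRingHom hinj (fun q => ?_)
    (sub_ne_zero.2 X_ne_one) mul_X_sub_one_ne_one
  · change Algebra.TensorProduct.lift _ _ _ (d ⊗ₜ[k] (1 : A)) = d
    refine (Algebra.TensorProduct.lift_tmul _ _ _ _ _).trans ?_
    rw [map_one, mul_one, AlgHom.id_apply]
  · induction q with | _ r s
    have hs : (OreLocalization.numeratorRingHom (s : SkewLaurent φ) :
        OreLocalization (SkewLaurent φ)⁰ (SkewLaurent φ)) ≠ 0 :=
      (map_ne_zero_iff _ hinj).2 (nonZeroDivisors.coe_ne_zero s)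
    refine ⟨s, r, hs, ?_⟩
    rw [eq_inv_mul_iff_mul_eq₀ hs]
    exact OreLocalization.mul_cancel

theorem proposition1
    (k : Type u) [Field k] [Fintype k]
    (A : Type u) [Ring A] [Nontrivial A] [Algebra k A]
    (hA : IsElementary k A)
    (hQ : (gabrielQuiver A).TotallyDisconnected)
    (K : Type u) [Field K] [IsAlgClosed K] [Algebra k K] :
    (IsNoetherianRing (CozzensRing k K ⊗[k] A) ∧
      IsNoetherianRing (CozzensRing k K ⊗[k] A)ᵐᵒᵖ) ∧
    Nonempty (FinLen A ≌ FinLen (CozzensRing k K ⊗[k] A)) ∧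
    (FinLenHasCSL A ∧ FinLenHasCSL (CozzensRing k K ⊗[k] A)) ∧
    (ModHasCSL A ∧ ¬ ModHasCSL (CozzensRing k K ⊗[k] A)) := by
  have hfin : Module.Finite k A := hA.1
  have hfin' : Module.Finite k Aᵐᵒᵖ := Module.Finite.equiv (MulOpposite.opLinearEquiv k)
  obtain ⟨n, π, hsurj, hπ⟩ := hA.exists_nilpotentKer
  set φ := FiniteField.frobeniusAlgEquiv k K (ringExpChar K)
  have hφ : ∀ a, φ a = a ^ Fintype.card k := fun _ => rfl
  let ε := SkewLaurent.tensorOpEquiv φ A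
  have hCSL : ModHasCSL A := modHasCSL_of_isElementary hA hQ
  refine ⟨⟨SkewLaurent.isNoetherianRing_tensor φ A, ?_⟩, ⟨?_⟩, ⟨fun M _ => hCSL M trivial, ?_⟩,
    hCSL, ?_⟩
  · have := SkewLaurent.isNoetherianRing_tensor φ Aᵐᵒᵖ
    exact isNoetherianRing_of_ringEquiv _ ε.symm
  · have := SkewLaurent.fixedPointsFunctor_isEquivalence hφ hπ.mulOpposite
    exact (SkewLaurent.fixedPointsFunctor hφ hπ.mulOpposite).asEquivalence.symm.trans
      ε.finiteLengthEquivalence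
  · intro M hM hdiv
    let _ : Module (SkewLaurent φ ⊗[k] Aᵐᵒᵖ) M := Module.compHom M ε.symm.toRingHom
    have hcompat : ∀ r (m : M), ε r • m = r • m := fun r m => by
      change ε.symm (ε r) • m = r • m
      rw [ε.symm_apply_apply]
    have hM' := ε.isFiniteLength hcompat hM
    have hspan := SkewLaurent.fixedSpanned_of_isFiniteLength hφ hπ.mulOpposite M hM'
    have hsimple := hCSL (ModuleCat.of _ (SkewLaurent.fixedPoints φ Aᵐᵒᵖ M)) trivial
      ((hdiv.of_ringEquiv (ε.moduleEnd hcompat)).of_ringEquiv (SkewLaurent.endEquiv hφ hspan))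
    refine ε.symm.isSimpleModule (fun s m => ?_)
      (SkewLaurent.isSimpleModule_of_fixedPoints hφ hπ.mulOpposite hM' hsimple)
    rw [← hcompat, ε.apply_symm_apply]
  · have hn : n ≠ 0 := by
      rintro rfl
      obtain ⟨N, hN⟩ := hπ
      have := hN (List.replicate N 1) (by simp) (fun _ _ => Subsingleton.elim _ _)
      rw [List.prod_replicate, one_pow] at this
      exact one_ne_zero this
    exact SkewLaurent.not_modHasCSL φ (component π ⟨0, Nat.pos_of_ne_zero hn⟩)
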